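/- Let $A\in GL(k,\mathbb Z)$ have $k$ real eigenvalues $B_1,\dots,B_k$ with $$|B_1|<\cdots<|B_j|<1<|B_{j+1}|<\cdots<|B_k|$$ and eigenvectors $v_1,\dots,v_k$ forming a basis of $\mathbb R^k$; we also write $A$ for the induced automorphism of $\mathbb T^k=\mathbb R^k/\mathbb Z^k$. Let $p:\mathbb T^k\to\mathbb R$ be of class $C^{k+1}$, let $l\le j$, let $\lambda\in(|B_l|,|B_{l+1}|)\cap(0,1)$, and put $$\phi(x)=\sum_{n=0}^{\infty}\lambda^n p(A^{-n}x),\qquad x\in\mathbb T^k .$$ For $x\in\mathbb T^k$ and $r>0$ let $\phi_i=\phi_{i}^{x}:[-r,r]\to\mathbb R$, $\phi_i(t)=\phi(x+tv_i)$ $(1\le i\le k)$, be the sub-slices of $\phi$ at $x$. For an almost periodic $q:\mathbb R\to\mathbb R$ write $q_a=\lim_{T\to\infty}\frac1{2T}\int_{-T}^{T}q(t)e^{-iat}\,dt$. For $i\le l$ and $\sigma\in\mathbb R\setminus\{0\}$ let $$(g_i^{x})_\sigma=\sum_{n\in\mathbb Z}\lambda^n\,(q_{i,n}^x)_{\sigma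 B_i^{\,n}},\qquad q_{i,n}^x(t)=p(A^{-n}x+tv_i),$$ be the Fourier coefficients of the formal series $g_i^x(t)=\sum_{n\in\mathbb Z}\lambda^n p(A^{-n}(x+tv_i))=\sum_{n\in\mathbb Z}\lambda^n q_{i,n}^x(B_i^{-n}t)$. (If $Ax=x$, then $q^x_{i,n}=q_i$ with $q_i(t)=p(x+tv_i)$ for all $n$, and $g_i^x(t)=\sum_{n\in\mathbb Z}\lambda^nq_i(B_i^{-n}t)$.) Fix $x\in\mathbb T^k$ and suppose that $(g_i^x)_\sigma\ne0$ for some $i\le l$ and $\sigma\neq 0$; let $i_0$ be the smallest such $i$. Suppose that there are $i_1\in\{i_0+1,\dots,l\}$ and $\sigma_1\ne 0$ with $(g_{i_1}^x)_{\sigma_1}\neq0$. Suppose moreover that either (a) the characteristic polynomial of $A$ is irreducible over $\mathbb Q$, or (b) $x$ is a periodic point of $A$ (for instance $x=0$), and $(g_i^y)_\sigma=0$ for all $i<i_0$, $\sigma\ne0$ and all $y\in\mathbb T^k$. Then, for every $r>0$, the box dimensions of $\mathrm{graph}(\phi)\subset\mathbb T^k\times\mathbb R$ and of $\mathrm{graph}(\phi_i)\subset\mathbb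 R^2$ $(1\le i\le k)$ exist, and $$\dim(\mathrm{graph}(\phi))<\sum_{i=1}^{k}\dim(\mathrm{graph}(\phi_i)).$$ -/

import Mathlib

open Filter Topology

/-- The smallest number of sets of diameter at most `δ` whose union covers `X`. (For a totally
bounded `X` and `δ > 0` such finite covers exist.) -/
noncomputable def boxCoverNumber {M : Type*} [PseudoEMetricSpace M] (δ : ℝ) (X : Set M) : ℕ :=
  sInf {n : ℕ | ∃ U : Fin n → Set M,
    (∀ m, Metric.ediam (U m) ≤ ENNReal.ofReal δ) ∧ X ⊆ ⋃ m, U m}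

/-- `X` is a non-empty totally bounded set whose box dimension exists (that is, the lower and the
upper box dimensions agree) and equals `d`. -/
def HasBoxDim {M : Type*} [PseudoEMetricSpace M] (X : Set M) (d : ℝ) : Prop :=
  X.Nonempty ∧ TotallyBounded X ∧
    Tendsto (fun δ : ℝ => Real.log (boxCoverNumber δ X) / (-Real.log δ)) (𝓝[>] 0) (𝓝 d)

/-- The projection `ℝ^k → 𝕋^k = (ℝ/ℤ)^k`. -/
def torusProj {k : ℕ} (x : Fin k → ℝ) : UnitAddTorus (Fin k) :=
  fun m => (x m : UnitAddCircle)

/-- The automorphism of the torus induced by an element of `GL(k, ℤ)`. -/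
def toralMap {k : ℕ} (A : GL (Fin k) ℤ) (x : UnitAddTorus (Fin k)) : UnitAddTorus (Fin k) :=
  fun m => ∑ n, (A : Matrix (Fin k) (Fin k) ℤ) m n • x n

/-- `B 0, …, B (k-1)` are the eigenvalues of `A`, numbered with strictly increasing moduli,
none of modulus one (so that `A` is a linear Anosov diffeomorphism of the torus), and `v m` is
an eigenvector for `B m`; the `v m` form a basis of `ℝ^k`. -/
structure IsAnosovEigensystem {k : ℕ} (A : GL (Fin k) ℤ) (B : Fin k → ℝ)
    (v : Fin k → Fin k → ℝ) : Prop where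
  eigen : ∀ m, ((A : Matrix (Fin k) (Fin k) ℤ).map (Int.cast : ℤ → ℝ)).mulVec (v m) = B m • v m
  linearIndependent : LinearIndependent ℝ v
  strictMono : StrictMono fun m => |B m|
  hyperbolic : ∀ m, |B m| ≠ 1

/-- `p` is a function of class `C^r` on the torus: its lift to `ℝ^k` is of class `C^r`. -/
def TorusContDiff {k : ℕ} (r : ℕ) (p : UnitAddTorus (Fin k) → ℝ) : Prop :=
  ContDiff ℝ r fun x : Fin k → ℝ => p (torusProj x)

/-- `φ(x) = ∑_{n ≥ 0} λ^n p(A^{-n} x)`. -/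
noncomputable def skewPhi {k : ℕ} (A : GL (Fin k) ℤ) (lam : ℝ) (p : UnitAddTorus (Fin k) → ℝ)
    (x : UnitAddTorus (Fin k)) : ℝ :=
  ∑' n : ℕ, lam ^ n * p (toralMap (A⁻¹ ^ n) x)

/-- The graph of `φ`, a subset of `𝕋^k × ℝ`. -/
def phiGraph {k : ℕ} (A : GL (Fin k) ℤ) (lam : ℝ) (p : UnitAddTorus (Fin k) → ℝ) :
    Set (UnitAddTorus (Fin k) × ℝ) :=
  Set.range fun x => (x, skewPhi A lam p x)

/-- The graph over `[-r, r]` of the sub-slice function `t ↦ φ(x + t w)` through `x` in the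
direction `w`. -/
def subSliceGraph {k : ℕ} (A : GL (Fin k) ℤ) (lam : ℝ) (p : UnitAddTorus (Fin k) → ℝ)
    (x : UnitAddTorus (Fin k)) (w : Fin k → ℝ) (r : ℝ) : Set (ℝ × ℝ) :=
  (fun t : ℝ => (t, skewPhi A lam p (x + torusProj (t • w)))) '' Set.Icc (-r) r

/-- The Fourier coefficient `q_a = lim_{T → ∞} (1 / 2T) ∫_{-T}^{T} q(t) e^{-iat} dt` of an almost
periodic function `q`. -/
noncomputable def bohrCoeff (q : ℝ → ℝ) (a : ℝ) : ℂ :=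
  limUnder atTop fun T : ℝ =>
    (1 / (2 * (T : ℂ))) * ∫ t in (-T)..T, (q t : ℂ) * Complex.exp (-(Complex.I * a * t))

/-- The Fourier coefficient of frequency `σ` of the formal two-sided series
`g(t) = ∑_{n ∈ ℤ} λ^n p(A^{-n}(x + t w))`, where `w` is an eigenvector of `A` with eigenvalue `b`.
As `p(A^{-n}(x + t w)) = q_n(b^{-n} t)` for `q_n(t) = p(A^{-n} x + t w)`, it is
`g_σ = ∑_{n ∈ ℤ} λ^n (q_n)_{σ b^n}`. If `A x = x`, all the `q_n` are equal to
`q(t) = p(x + t w)`, and `g(t) = ∑_{n ∈ ℤ} λ^n q(b^{-n} t)`, `g_σ = ∑_{n ∈ ℤ} λ^n q_{σ b^n}`. -/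
noncomputable def gCoeff {k : ℕ} (A : GL (Fin k) ℤ) (lam : ℝ) (p : UnitAddTorus (Fin k) → ℝ)
    (x : UnitAddTorus (Fin k)) (b : ℝ) (w : Fin k → ℝ) (σ : ℝ) : ℂ :=
  ∑' n : ℤ, (lam : ℂ) ^ n *
    bohrCoeff (fun t : ℝ => p (toralMap (A ^ (-n)) x + torusProj (t • w))) (σ * b ^ n)

/-- The series `g` at the point `x` in the direction `w` has a nonzero Fourier coefficient.
The frequency `σ = 0` is left out: for a fixed point `x` the series `∑_{n ∈ ℤ} λ^n q_0` converges
only if `q_0 = 0`. -/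
def HasNonzeroCoeff {k : ℕ} (A : GL (Fin k) ℤ) (lam : ℝ) (p : UnitAddTorus (Fin k) → ℝ)
    (x : UnitAddTorus (Fin k)) (b : ℝ) (w : Fin k → ℝ) : Prop :=
  ∃ σ : ℝ, σ ≠ 0 ∧ gCoeff A lam p x b w σ ≠ 0

/-! Fix an eigendirection `w` with eigenvalue `b`, `|b| < lam`. The increment of `φ` along `w` is
one half of a two-sided series `G_s(y) = ∑_{n ∈ ℤ} lam^n (p(A^{-n}(y + s w)) - p(A^{-n} y))`, called
`twoSided`. The other half is `O(|s|)` (`IsFractalDirection.skewPhi_sub_le`), so `G` carries all the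
roughness of `φ` along `w`. Unlike `φ`, it is exactly self-similar: `G_{b^N s}(y) = lam^N G_s(A^{-N}
y)`. Hence `G` is Hölder in `s` with exponent `α = log lam / log |b| < 1`.

The Fourier coefficients of `t ↦ G_s(x + t w)` are `g_σ (e^{iσs} - 1)`, so a nonzero `g_σ` with `σ ≠
0` makes `G` nonzero at `x`. Conversely, if they all vanish, `G_s` is constant along the line, hence
additive in `s`, and sublinear Hölder growth forces `G = 0`. This gives a dichotomy for slices. If
`G` vanishes at `x`, then `φ` is Lipschitz on the line and the slice has dimension `1`. Otherwise
its mean oscillation at scale `|b|^n` is of order `lam^n`, and the slice has dimension `2 - α`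
(`IsFractalDirection.hasBoxDim_slice`).

Irreducibility or periodicity enters twice. It keeps the points `A^{-n} x` (for `n` in a suitable
progression) in the closure of the line through `x`, which makes the lower bound uniform in `n`.
Together with the extra assumption in the periodic case, it also makes `G` vanish at every point of
the torus in the directions before `i₀`; under irreducibility this follows from the density of
eigenlines. Thus `φ` is globally Hölder with the exponent `α` of direction `i₀`, the smallest that
remains, and its graph has dimension `k + 1 - α_{i₀}` (`IsFractalDirection.hasBoxDim_phiGraph`).

Every slice has dimension at least `1`, and two of them have dimensions `2 - α_{i₀}` and `2 -
α_{i₁}`. The sum is therefore at least `k + 2 - α_{i₀} - α_{i₁}`, which exceeds `k + 1 - α_{i₀}`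
because `α_{i₁} < 1`. -/

open MeasureTheory

/-! ### Lines on the torus, toral automorphisms and their eigendirections. -/

namespace SkewSlice

variable {k : ℕ}

/-- The one-parameter subgroup of the torus in the direction `w`. -/
noncomputable def line (w : Fin k → ℝ) (t : ℝ) : UnitAddTorus (Fin k) := torusProj (t • w)

theorem torusProj_add (u v : Fin k → ℝ) : torusProj (u + v) = torusProj u + torusProj v := rfl

theorem torusProj_zero : torusProj (0 : Fin k → ℝ) = 0 := rfl

theorem continuous_torusProj : Continuous (torusProj (k := k)) :=
  continuous_pi fun m => (AddCircle.continuous_mk' 1).comp (continuous_apply m)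

theorem norm_torusProj_le (u : Fin k → ℝ) : ‖torusProj u‖ ≤ ‖u‖ := by
  refine (pi_norm_le_iff_of_nonneg (norm_nonneg _)).2 fun m => ?_
  refine le_trans ?_ (norm_le_pi_norm u m)
  rw [torusProj, UnitAddCircle.norm_eq, Real.norm_eq_abs]
  simpa using round_le (u m) 0

/-- Subtracting the nearest integer in each coordinate gives the shortest representative; estimates
on `ℝ^k` pass to the torus this way. -/
theorem exists_lift (y : UnitAddTorus (Fin k)) : ∃ u : Fin k → ℝ, torusProj u = y ∧ ‖u‖ ≤ ‖y‖ := by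
  have h : ∀ m, ∃ s : ℝ, (s : UnitAddCircle) = y m ∧ |s| ≤ ‖y m‖ := by
    intro m
    obtain ⟨s, hs⟩ := QuotientAddGroup.mk_surjective (y m)
    refine ⟨s - round s, ?_, ?_⟩
    · have : ((round s : ℝ) : UnitAddCircle) = 0 := by
        exact (AddCircle.coe_eq_zero_iff (p := (1 : ℝ))).2 ⟨round s, by simp⟩
      rw [AddCircle.coe_sub, this, sub_zero]
      exact hs
    · rw [← hs]
      exact (UnitAddCircle.norm_eq (x := s)).ge
  choose u hu hu' using h
  refine ⟨u, funext hu, (pi_norm_le_iff_of_nonneg (norm_nonneg _)).2 fun m => ?_⟩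
  exact (hu' m).trans (norm_le_pi_norm y m)

theorem line_add (w : Fin k → ℝ) (s t : ℝ) : line w (s + t) = line w s + line w t := by
  rw [line, add_smul, torusProj_add]; rfl

theorem line_zero (w : Fin k → ℝ) : line w 0 = 0 := by
  rw [line, zero_smul, torusProj_zero]

theorem line_neg (w : Fin k → ℝ) (s : ℝ) : line w (-s) = -line w s := by
  rw [eq_neg_iff_add_eq_zero, ← line_add, neg_add_cancel, line_zero]

theorem continuous_line (w : Fin k → ℝ) : Continuous (line w) :=
  continuous_torusProj.comp (by fun_prop)

theorem norm_line_le (w : Fin k → ℝ) (t : ℝ) : ‖line w t‖ ≤ |t| * ‖w‖ :=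
  (norm_torusProj_le _).trans (norm_smul_le t w)

theorem toralMap_add (A : GL (Fin k) ℤ) (x y : UnitAddTorus (Fin k)) :
    toralMap A (x + y) = toralMap A x + toralMap A y := by
  funext m
  simp [toralMap, smul_add, Finset.sum_add_distrib]

theorem toralMap_one (x : UnitAddTorus (Fin k)) : toralMap 1 x = x := by
  funext m
  simp [toralMap, Matrix.one_apply, ite_smul]

theorem toralMap_mul (A A' : GL (Fin k) ℤ) (x : UnitAddTorus (Fin k)) :
    toralMap (A * A') x = toralMap A (toralMap A' x) := by
  funext m
  simp only [toralMap, Units.val_mul, Matrix.mul_apply, Finset.sum_smul, Finset.smul_sum, mul_smul]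
  rw [Finset.sum_comm]

theorem continuous_toralMap (A : GL (Fin k) ℤ) : Continuous (toralMap A) :=
  continuous_pi fun _ => continuous_finsetSum _ fun n _ => (continuous_apply n).zsmul _

theorem toralMap_torusProj (A : GL (Fin k) ℤ) (u : Fin k → ℝ) :
    toralMap A (torusProj u) =
      torusProj (((A : Matrix (Fin k) (Fin k) ℤ).map (Int.cast : ℤ → ℝ)).mulVec u) := by
  funext m
  simp only [toralMap, torusProj, Matrix.mulVec, dotProduct, Matrix.map_apply]
  rw [← QuotientAddGroup.mk'_apply, map_sum]
  refine Finset.sum_congr rfl fun n _ => ?_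
  rw [← zsmul_eq_mul, map_zsmul]
  rfl

theorem toralMap_surjective (A : GL (Fin k) ℤ) : Function.Surjective (toralMap A) := fun y =>
  ⟨toralMap A⁻¹ y, by rw [← toralMap_mul, mul_inv_cancel, toralMap_one]⟩

/-- A continuous surjective endomorphism of a compact group preserves its Haar measure. -/
theorem measurePreserving_toralMap (A : GL (Fin k) ℤ) :
    MeasurePreserving (toralMap A) (volume : Measure (UnitAddTorus (Fin k))) volume :=
  AddMonoidHom.measurePreserving (f := AddMonoidHom.mk' (toralMap A) (toralMap_add A))
    (continuous_toralMap A) (toralMap_surjective A) rfl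

/-- `w` is an eigenvector of `A` with eigenvalue `b`. -/
def IsEigen (A : GL (Fin k) ℤ) (b : ℝ) (w : Fin k → ℝ) : Prop :=
  ((A : Matrix (Fin k) (Fin k) ℤ).map (Int.cast : ℤ → ℝ)).mulVec w = b • w

theorem IsEigen.mul {A A' : GL (Fin k) ℤ} {b b' : ℝ} {w : Fin k → ℝ} (h : IsEigen A b w)
    (h' : IsEigen A' b' w) : IsEigen (A * A') (b * b') w := by
  unfold IsEigen at *
  rw [Units.val_mul, Matrix.map_mul_intCast, ← Matrix.mulVec_mulVec, h', Matrix.mulVec_smul, h,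
    smul_smul, mul_comm]

theorem isEigen_one (w : Fin k → ℝ) : IsEigen 1 1 w := by
  simp [IsEigen]

theorem IsEigen.ne_zero {A : GL (Fin k) ℤ} {b : ℝ} {w : Fin k → ℝ} (h : IsEigen A b w)
    (hw : w ≠ 0) : b ≠ 0 := by
  rintro rfl
  have h1 : (((A⁻¹ * A : GL (Fin k) ℤ) : Matrix (Fin k) (Fin k) ℤ).map (Int.cast : ℤ → ℝ)).mulVec w
      = 0 := by
    unfold IsEigen at h
    rw [Units.val_mul, Matrix.map_mul_intCast, ← Matrix.mulVec_mulVec, h, zero_smul,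
      Matrix.mulVec_zero]
  rw [inv_mul_cancel] at h1
  simp at h1
  exact hw h1

theorem IsEigen.inv {A : GL (Fin k) ℤ} {b : ℝ} {w : Fin k → ℝ} (h : IsEigen A b w)
    (hb : b ≠ 0) : IsEigen A⁻¹ b⁻¹ w := by
  have h1 : (((A⁻¹ * A : GL (Fin k) ℤ) : Matrix (Fin k) (Fin k) ℤ).map (Int.cast : ℤ → ℝ)).mulVec w
      = w := by
    rw [inv_mul_cancel]; simp
  unfold IsEigen at *
  rw [Units.val_mul, Matrix.map_mul_intCast, ← Matrix.mulVec_mulVec, h, Matrix.mulVec_smul] at h1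
  rw [← h1, smul_smul, inv_mul_cancel₀ hb, one_smul, h1]

theorem IsEigen.pow {A : GL (Fin k) ℤ} {b : ℝ} {w : Fin k → ℝ} (h : IsEigen A b w) (n : ℕ) :
    IsEigen (A ^ n) (b ^ n) w := by
  induction n with
  | zero => simpa using isEigen_one w
  | succ n ih => rw [pow_succ, pow_succ]; exact ih.mul h

theorem IsEigen.zpow {A : GL (Fin k) ℤ} {b : ℝ} {w : Fin k → ℝ} (h : IsEigen A b w)
    (hb : b ≠ 0) (n : ℤ) : IsEigen (A ^ n) (b ^ n) w := by
  cases n with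
  | ofNat n => simpa using h.pow n
  | negSucc n =>
    rw [zpow_negSucc, zpow_negSucc]
    exact (h.pow _).inv (pow_ne_zero _ hb)

theorem IsEigen.toralMap_line {A : GL (Fin k) ℤ} {b : ℝ} {w : Fin k → ℝ} (h : IsEigen A b w)
    (t : ℝ) : toralMap A (line w t) = line w (b * t) := by
  unfold IsEigen at h
  rw [line, toralMap_torusProj, Matrix.mulVec_smul, h, smul_smul, line, mul_comm]

/-- The action of `A^{-n}` on the torus. -/
def backward (A : GL (Fin k) ℤ) (n : ℤ) (y : UnitAddTorus (Fin k)) : UnitAddTorus (Fin k) :=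
  toralMap (A ^ (-n)) y

theorem backward_backward (A : GL (Fin k) ℤ) (m n : ℤ) (y : UnitAddTorus (Fin k)) :
    backward A m (backward A n y) = backward A (m + n) y := by
  rw [backward, backward, backward, ← toralMap_mul, ← zpow_add, neg_add]

theorem continuous_backward (A : GL (Fin k) ℤ) (n : ℤ) : Continuous (backward A n) :=
  continuous_toralMap _

theorem IsEigen.backward_add_line {A : GL (Fin k) ℤ} {b : ℝ} {w : Fin k → ℝ} (h : IsEigen A b w)
    (hb : b ≠ 0) (n : ℤ) (y : UnitAddTorus (Fin k)) (t : ℝ) :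
    backward A n (y + line w t) = backward A n y + line w (b ^ (-n) * t) := by
  rw [backward, toralMap_add, (h.zpow hb (-n)).toralMap_line]; rfl

theorem continuous_of_torusContDiff {n : ℕ} {p : UnitAddTorus (Fin k) → ℝ}
    (hp : TorusContDiff n p) : Continuous p := by
  have hq : IsOpenQuotientMap (torusProj (k := k)) := by
    refine IsOpenQuotientMap.piMap (f := fun _ : Fin k => ((↑) : ℝ → UnitAddCircle)) fun _ => ?_
    exact QuotientAddGroup.isOpenQuotientMap_mk
  exact hq.isQuotientMap.continuous_iff.2 (ContDiff.continuous hp)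

theorem exists_bound {p : UnitAddTorus (Fin k) → ℝ} (hp : Continuous p) :
    ∃ M, 0 ≤ M ∧ ∀ y, |p y| ≤ M := by
  obtain ⟨M, hM⟩ := (isCompact_univ (X := UnitAddTorus (Fin k))).exists_bound_of_continuousOn
    hp.continuousOn
  exact ⟨M, (norm_nonneg _).trans (hM 0 trivial), fun y => hM y trivial⟩

theorem exists_lipschitz {n : ℕ} (hn : 1 ≤ n) {p : UnitAddTorus (Fin k) → ℝ}
    (hp : TorusContDiff n p) : ∃ L, 0 ≤ L ∧ ∀ y h, |p (y + h) - p y| ≤ L * ‖h‖ := by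
  set P : (Fin k → ℝ) → ℝ := fun x => p (torusProj x) with hP
  have hP1 : ContDiff ℝ 1 P := hp.of_le (by exact_mod_cast hn)
  have hcont : Continuous (fderiv ℝ P) := hP1.continuous_fderiv (by norm_num)
  -- Base point and increment have lifts of norm at most `1`, so the segment between the two lifted
  -- points stays in the ball of radius `2`.
  obtain ⟨L, hL⟩ := (isCompact_closedBall (0 : Fin k → ℝ) 2).exists_bound_of_continuousOn
    hcont.continuousOn
  refine ⟨L, (norm_nonneg _).trans (hL 0 (by simp)), fun y h => ?_⟩
  have hsmall : ∀ z : UnitAddTorus (Fin k), ‖z‖ ≤ 1 := fun z => by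
    refine (pi_norm_le_iff_of_nonneg zero_le_one).2 fun m => ?_
    refine (AddCircle.norm_le_half_period 1 one_ne_zero).trans ?_
    norm_num
  obtain ⟨u, rfl, hu⟩ := exists_lift y
  obtain ⟨v, rfl, hv⟩ := exists_lift h
  have hu1 := hu.trans (hsmall _)
  have hv1 := hv.trans (hsmall _)
  have := (convex_closedBall (0 : Fin k → ℝ) 2).norm_image_sub_le_of_norm_fderiv_le (𝕜 := ℝ)
    (f := P) (C := L) (x := u) (y := u + v) (fun x _ => hP1.differentiable (by norm_num) x)
    hL (by simp; linarith) (by simp; linarith [norm_add_le u v])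
  rw [← torusProj_add]
  refine (this.trans ?_)
  rw [add_sub_cancel_left]
  exact mul_le_mul_of_nonneg_left hv ((norm_nonneg _).trans (hL 0 (by simp)))

end SkewSlice

/-! ### The two-sided series: convergence, scaling, Hölder bound. -/

namespace SkewSlice

variable {k : ℕ}

/-- `p` is a bounded Lipschitz function on the torus. -/
structure IsBoundedLipschitz (p : UnitAddTorus (Fin k) → ℝ) : Prop where
  cont : Continuous p
  bdd : ∃ M, 0 ≤ M ∧ ∀ y, |p y| ≤ M
  lip : ∃ L, 0 ≤ L ∧ ∀ y h, |p (y + h) - p y| ≤ L * ‖h‖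

/-- `w` is a direction contracted by `A` at a rate stronger than `lam`. -/
structure IsFractalDirection (A : GL (Fin k) ℤ) (lam b : ℝ) (w : Fin k → ℝ) : Prop where
  eigen : IsEigen A b w
  ne_zero : b ≠ 0
  lam_pos : 0 < lam
  lam_lt_one : lam < 1
  abs_lt : |b| < lam

section Phi

variable {A : GL (Fin k) ℤ} {lam : ℝ} {p : UnitAddTorus (Fin k) → ℝ}

theorem skewPhi_eq (A : GL (Fin k) ℤ) (lam : ℝ) (p : UnitAddTorus (Fin k) → ℝ)
    (y : UnitAddTorus (Fin k)) :
    skewPhi A lam p y = ∑' n : ℕ, lam ^ n * p (backward A n y) := by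
  simp [skewPhi, backward]

theorem norm_pow_mul_le {M : ℝ} (hM : ∀ y, |p y| ≤ M) (h0 : 0 < lam) (n : ℕ)
    (y : UnitAddTorus (Fin k)) : ‖lam ^ n * p y‖ ≤ M * lam ^ n := by
  rw [norm_mul, norm_pow, Real.norm_of_nonneg h0.le, Real.norm_eq_abs, mul_comm]
  exact mul_le_mul_of_nonneg_right (hM _) (pow_nonneg h0.le _)

theorem summable_skewPhi (hp : IsBoundedLipschitz p) (h0 : 0 < lam) (h1 : lam < 1)
    (y : UnitAddTorus (Fin k)) : Summable fun n : ℕ => lam ^ n * p (backward A n y) := by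
  obtain ⟨M, hM0, hM⟩ := hp.bdd
  exact Summable.of_norm_bounded ((summable_geometric_of_lt_one h0.le h1).mul_left M)
    fun n => norm_pow_mul_le hM h0 n _

theorem continuous_skewPhi (hp : IsBoundedLipschitz p) (h0 : 0 < lam) (h1 : lam < 1) :
    Continuous (skewPhi A lam p) := by
  obtain ⟨M, hM0, hM⟩ := hp.bdd
  rw [funext (skewPhi_eq A lam p)]
  exact continuous_tsum (fun n => continuous_const.mul (hp.cont.comp (continuous_backward A n)))
    ((summable_geometric_of_lt_one h0.le h1).mul_left M) fun n y => norm_pow_mul_le hM h0 n _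

/-- In a direction which is expanded, or contracted at a rate weaker than `lam`, the function
`φ` is Lipschitz. -/
theorem skewPhi_lipschitz_of_lt (hp : IsBoundedLipschitz p) (h0 : 0 < lam) (h1 : lam < 1) {b : ℝ}
    {w : Fin k → ℝ} (hw : IsEigen A b w) (hb : b ≠ 0) (hlt : lam < |b|) :
    ∃ C, 0 ≤ C ∧ ∀ y s, |skewPhi A lam p (y + line w s) - skewPhi A lam p y| ≤ C * |s| := by
  obtain ⟨L, hL0, hL⟩ := hp.lip
  have hb0 : 0 < |b| := abs_pos.2 hb
  have hq : lam / |b| < 1 := (div_lt_one hb0).2 hlt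
  have hq0 : 0 ≤ lam / |b| := by positivity
  have hgeo := hasSum_geometric_of_lt_one hq0 hq
  refine ⟨L * ‖w‖ * (1 - lam / |b|)⁻¹, by have := sub_pos.2 hq; positivity, fun y s => ?_⟩
  rw [skewPhi_eq, skewPhi_eq, ← (summable_skewPhi hp h0 h1 _).tsum_sub (summable_skewPhi hp h0 h1 _)]
  rw [← Real.norm_eq_abs]
  have := tsum_of_norm_bounded (f := fun n : ℕ => lam ^ n * p (backward A n (y + line w s)) -
    lam ^ n * p (backward A n y)) (hgeo.mul_left (L * ‖w‖ * |s|)) (fun n => ?_)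
  · refine this.trans (le_of_eq (by ring))
  · rw [← mul_sub, hw.backward_add_line hb, norm_mul, norm_pow, Real.norm_of_nonneg h0.le]
    calc _ ≤ lam ^ n * (L * (|b ^ (-(n : ℤ)) * s| * ‖w‖)) := by
          refine mul_le_mul_of_nonneg_left ((hL _ _).trans ?_) (by positivity)
          exact mul_le_mul_of_nonneg_left (norm_line_le _ _) hL0
      _ = _ := by
          rw [abs_mul, abs_zpow, zpow_neg, zpow_natCast, div_pow]
          field_simp

end Phi

/-- The terms of the two-sided series `g`, normalized at the base point. -/
noncomputable def twoSidedTerm (A : GL (Fin k) ℤ) (lam : ℝ) (p : UnitAddTorus (Fin k) → ℝ)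
    (w : Fin k → ℝ) (s : ℝ) (y : UnitAddTorus (Fin k)) (n : ℤ) : ℝ :=
  lam ^ n * (p (backward A n (y + line w s)) - p (backward A n y))

/-- The two-sided series `g`, normalized at the base point: formally `g^y(s) - g^y(0)`. -/
noncomputable def twoSided (A : GL (Fin k) ℤ) (lam : ℝ) (p : UnitAddTorus (Fin k) → ℝ)
    (w : Fin k → ℝ) (s : ℝ) (y : UnitAddTorus (Fin k)) : ℝ :=
  ∑' n : ℤ, twoSidedTerm A lam p w s y n

variable {A : GL (Fin k) ℤ} {lam b : ℝ} {w : Fin k → ℝ} {p : UnitAddTorus (Fin k) → ℝ}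

theorem IsFractalDirection.abs_pos (hd : IsFractalDirection A lam b w) : 0 < |b| :=
  _root_.abs_pos.2 hd.ne_zero

theorem IsFractalDirection.term_le_zpow (hd : IsFractalDirection A lam b w) {L : ℝ} (hL0 : 0 ≤ L)
    (hL : ∀ y h, |p (y + h) - p y| ≤ L * ‖h‖) (s : ℝ) (y : UnitAddTorus (Fin k)) (n : ℤ) :
    |twoSidedTerm A lam p w s y n| ≤ L * ‖w‖ * |s| * (lam ^ n * |b| ^ (-n)) := by
  have h0 := hd.lam_pos
  rw [twoSidedTerm, hd.eigen.backward_add_line hd.ne_zero, abs_mul, abs_of_pos (zpow_pos h0 n)]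
  calc _ ≤ lam ^ n * (L * (|b ^ (-n) * s| * ‖w‖)) := by
        refine mul_le_mul_of_nonneg_left ((hL _ _).trans ?_) (by positivity)
        exact mul_le_mul_of_nonneg_left (norm_line_le _ _) hL0
    _ = _ := by
        rw [abs_mul, abs_zpow]; ring

/-- Boundedness of `p` controls the terms with `n ≥ 0` (ratio `lam`), and its Lipschitz constant
those with `n ≤ 0` (ratio `|b| / lam`). The minimum of the two bounds is a summable majorant,
uniform in the base point. -/
theorem IsFractalDirection.exists_term_bound (hd : IsFractalDirection A lam b w)
    (hp : IsBoundedLipschitz p) (R : ℝ) :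
    ∃ u : ℤ → ℝ, Summable u ∧ ∀ s, |s| ≤ R → ∀ y n, |twoSidedTerm A lam p w s y n| ≤ u n := by
  obtain ⟨L, hL0, hL⟩ := hp.lip
  obtain ⟨M, hM0, hM⟩ := hp.bdd
  have h0 := hd.lam_pos
  have hb0 := hd.abs_pos
  rcases lt_or_ge R 0 with hR | hR
  · exact ⟨0, summable_zero, fun s hs => absurd (abs_nonneg s) (by linarith)⟩
  refine ⟨fun n => min (2 * M * lam ^ n) (L * ‖w‖ * R * (lam ^ n * |b| ^ (-n))), ?_, ?_⟩
  · refine Summable.of_nat_of_neg ?_ ?_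
    · refine Summable.of_nonneg_of_le (fun n => by positivity) (fun n => min_le_left _ _) ?_
      simpa using (summable_geometric_of_lt_one h0.le hd.lam_lt_one).mul_left (2 * M)
    · refine Summable.of_nonneg_of_le (fun n => by positivity) (fun n => min_le_right _ _) ?_
      have hq : |b| / lam < 1 := (div_lt_one h0).2 hd.abs_lt
      refine ((summable_geometric_of_lt_one (by positivity) hq).mul_left (L * ‖w‖ * R)).congr
        fun n => ?_
      rw [neg_neg, zpow_neg, zpow_natCast, zpow_natCast, div_pow]
      ring
  · intro s hs y n
    refine le_min ?_ ((hd.term_le_zpow hL0 hL s y n).trans ?_)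
    · rw [twoSidedTerm, abs_mul, abs_of_pos (zpow_pos h0 n), mul_comm]
      refine mul_le_mul_of_nonneg_right ?_ (by positivity)
      exact (abs_sub _ _).trans (by linarith [hM (backward A n (y + line w s)), hM (backward A n y)])
    · gcongr

theorem IsFractalDirection.summable_term (hd : IsFractalDirection A lam b w)
    (hp : IsBoundedLipschitz p) (s : ℝ) (y : UnitAddTorus (Fin k)) :
    Summable (twoSidedTerm A lam p w s y) := by
  obtain ⟨u, hu, hu'⟩ := hd.exists_term_bound hp |s|
  exact Summable.of_norm_bounded hu fun n => hu' s le_rfl y n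

theorem continuous_twoSidedTerm (hp : Continuous p) (s : ℝ) (n : ℤ) :
    Continuous fun y => twoSidedTerm A lam p w s y n :=
  continuous_const.mul ((hp.comp ((continuous_backward A n).comp (continuous_add_const _))).sub
    (hp.comp (continuous_backward A n)))

theorem IsFractalDirection.continuous_twoSided (hd : IsFractalDirection A lam b w)
    (hp : IsBoundedLipschitz p) (s : ℝ) : Continuous (twoSided A lam p w s) := by
  obtain ⟨u, hu, hu'⟩ := hd.exists_term_bound hp |s|
  exact continuous_tsum (fun n => continuous_twoSidedTerm hp.cont s n) hu
    fun n y => hu' s le_rfl y n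

theorem IsFractalDirection.exists_twoSided_bound (hd : IsFractalDirection A lam b w)
    (hp : IsBoundedLipschitz p) (R : ℝ) :
    ∃ K, ∀ s, |s| ≤ R → ∀ y, |twoSided A lam p w s y| ≤ K := by
  obtain ⟨u, hu, hu'⟩ := hd.exists_term_bound hp R
  exact ⟨∑' n, u n, fun s hs y => tsum_of_norm_bounded (f := twoSidedTerm A lam p w s y) hu.hasSum fun n => hu' s hs y n⟩

/-- Exact self-similarity, obtained by shifting the index by `N`; it is the reason for summing over
all of `ℤ`. -/
theorem IsFractalDirection.twoSided_zpow_mul (hd : IsFractalDirection A lam b w) (N : ℤ) (s : ℝ)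
    (y : UnitAddTorus (Fin k)) :
    twoSided A lam p w (b ^ N * s) y = lam ^ N * twoSided A lam p w s (backward A N y) := by
  rw [twoSided, twoSided, ← tsum_mul_left, ← (Equiv.addRight N).tsum_eq]
  refine tsum_congr fun n => ?_
  have h : ∀ z, backward A (n + N) z = backward A n (backward A N z) := fun z =>
    (backward_backward A n N z).symm
  simp only [Equiv.coe_addRight, twoSidedTerm]
  rw [h, h, hd.eigen.backward_add_line hd.ne_zero N, zpow_add₀ hd.lam_pos.ne', ← mul_assoc (b ^ (-N)),
    ← zpow_add₀ hd.ne_zero, neg_add_cancel, zpow_zero, one_mul]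
  ring

/-- The cocycle relation: moving along the line only changes the normalization at the base point. -/
theorem IsFractalDirection.twoSided_add (hd : IsFractalDirection A lam b w)
    (hp : IsBoundedLipschitz p) (s t : ℝ) (y : UnitAddTorus (Fin k)) :
    twoSided A lam p w (t + s) y - twoSided A lam p w t y =
      twoSided A lam p w s (y + line w t) := by
  rw [twoSided, twoSided, ← (hd.summable_term hp _ _).tsum_sub (hd.summable_term hp _ _), twoSided]
  refine tsum_congr fun n => ?_
  simp only [twoSidedTerm, line_add, add_assoc]
  ring

theorem twoSided_zero (y : UnitAddTorus (Fin k)) : twoSided A lam p w 0 y = 0 := by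
  simp [twoSided, twoSidedTerm, line_zero]

/-- The increment of `φ` is the half `n ≥ 0` of the series; the half `n < 0` is dominated by `|s|`
times a geometric series of ratio `|b| / lam`. -/
theorem IsFractalDirection.skewPhi_sub_le (hd : IsFractalDirection A lam b w)
    (hp : IsBoundedLipschitz p) :
    ∃ C, 0 ≤ C ∧ ∀ y s, |skewPhi A lam p (y + line w s) - skewPhi A lam p y
      - twoSided A lam p w s y| ≤ C * |s| := by
  obtain ⟨L, hL0, hL⟩ := hp.lip
  have h0 := hd.lam_pos
  have h1 := hd.lam_lt_one
  have hb0 := hd.abs_pos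
  have hq : |b| / lam < 1 := (div_lt_one h0).2 hd.abs_lt
  have hgeo := hasSum_geometric_of_lt_one (by positivity) hq
  refine ⟨L * ‖w‖ * (|b| / lam) * (1 - |b| / lam)⁻¹, by have := sub_pos.2 hq; positivity,
    fun y s => ?_⟩
  have hs := hd.summable_term hp s y
  have hs1 : Summable fun n : ℕ => twoSidedTerm A lam p w s y n :=
    hs.comp_injective Nat.cast_injective
  have hs2 : Summable fun n : ℕ => twoSidedTerm A lam p w s y (-(n + 1 : ℤ)) :=
    hs.comp_injective (i := fun n : ℕ => (-(n + 1 : ℤ))) fun m n h => by simpa using h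
  have e1 : twoSided A lam p w s y = ∑' n : ℕ, twoSidedTerm A lam p w s y n +
      ∑' n : ℕ, twoSidedTerm A lam p w s y (-(n + 1 : ℤ)) :=
    (HasSum.of_nat_of_neg_add_one hs1.hasSum hs2.hasSum).tsum_eq
  have e2 : skewPhi A lam p (y + line w s) - skewPhi A lam p y =
      ∑' n : ℕ, twoSidedTerm A lam p w s y n := by
    rw [skewPhi_eq, skewPhi_eq,
      ← (summable_skewPhi hp h0 h1 _).tsum_sub (summable_skewPhi hp h0 h1 _)]
    refine tsum_congr fun n => ?_
    rw [twoSidedTerm, zpow_natCast, mul_sub]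
  rw [e1, e2, sub_add_cancel_left, abs_neg]
  have := tsum_of_norm_bounded (f := fun n : ℕ => twoSidedTerm A lam p w s y (-(n + 1 : ℤ)))
    (hgeo.mul_left (L * ‖w‖ * |s| * (|b| / lam))) (fun n => ?_)
  · refine this.trans (le_of_eq (by ring))
  · refine (hd.term_le_zpow hL0 hL s y _).trans (le_of_eq ?_)
    have : ((n : ℤ) + 1) = ((n + 1 : ℕ) : ℤ) := by push_cast; rfl
    rw [neg_neg, this, zpow_neg, zpow_natCast, zpow_natCast, pow_succ, pow_succ, div_pow]
    field_simp

/-- The Hölder exponent of `φ` in a direction contracted at the rate `b`. -/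
noncomputable def holderExp (lam b : ℝ) : ℝ := Real.log lam / Real.log |b|

theorem IsFractalDirection.abs_lt_one (hd : IsFractalDirection A lam b w) : |b| < 1 :=
  hd.abs_lt.trans hd.lam_lt_one

theorem IsFractalDirection.log_abs_neg (hd : IsFractalDirection A lam b w) : Real.log |b| < 0 :=
  Real.log_neg hd.abs_pos hd.abs_lt_one

theorem IsFractalDirection.holderExp_pos (hd : IsFractalDirection A lam b w) :
    0 < holderExp lam b :=
  div_pos_of_neg_of_neg (Real.log_neg hd.lam_pos hd.lam_lt_one) hd.log_abs_neg

theorem IsFractalDirection.holderExp_lt_one (hd : IsFractalDirection A lam b w) :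
    holderExp lam b < 1 :=
  (div_lt_one_of_neg hd.log_abs_neg).2 (Real.log_lt_log hd.abs_pos hd.abs_lt)

theorem IsFractalDirection.rpow_holderExp (hd : IsFractalDirection A lam b w) :
    |b| ^ holderExp lam b = lam := by
  rw [Real.rpow_def_of_pos hd.abs_pos, holderExp, mul_div_cancel₀ _ hd.log_abs_neg.ne,
    Real.exp_log hd.lam_pos]

theorem IsFractalDirection.zpow_rpow_holderExp (hd : IsFractalDirection A lam b w) (N : ℤ) :
    (|b| ^ N) ^ holderExp lam b = lam ^ N := by
  rw [← Real.rpow_intCast, ← Real.rpow_mul hd.abs_pos.le, mul_comm,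
    Real.rpow_mul hd.abs_pos.le, hd.rpow_holderExp, Real.rpow_intCast]

/-- Self-similarity reduces any `s ≠ 0` to `|s| ≤ 1`, where the series is uniformly bounded; the
scaling factor is a power of `lam`, that is, the `α`-th power of a power of `|b|`. -/
theorem IsFractalDirection.exists_twoSided_holder (hd : IsFractalDirection A lam b w)
    (hp : IsBoundedLipschitz p) :
    ∃ K, 0 ≤ K ∧ ∀ y s, |twoSided A lam p w s y| ≤ K * |s| ^ holderExp lam b := by
  obtain ⟨K, hK⟩ := hd.exists_twoSided_bound hp 1
  have hK0 : 0 ≤ K := (abs_nonneg _).trans (hK 0 (by simp) 0)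
  have h0 := hd.lam_pos
  have hb0 := hd.abs_pos
  have hα := hd.holderExp_pos
  refine ⟨K / lam, by positivity, fun y s => ?_⟩
  rcases eq_or_ne s 0 with rfl | hs
  · rw [twoSided_zero, abs_zero]; positivity
  have hs0 : 0 < |s| := _root_.abs_pos.2 hs
  -- This `N` satisfies `|b|^(-N) < |s| ≤ |b|^(-(N+1))`, so `b^(N+1) s` has modulus at most `1`; the
  -- off-by-one costs the factor `1 / lam`.
  obtain ⟨N, hN1, hN2⟩ := exists_mem_Ioc_zpow hs0 (one_lt_inv₀ hb0 |>.2 hd.abs_lt_one)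
  rw [inv_zpow'] at hN1 hN2
  have e : s = b ^ (-(N + 1)) * (b ^ (N + 1) * s) := by
    rw [← mul_assoc, ← zpow_add₀ hd.ne_zero, neg_add_cancel, zpow_zero, one_mul]
  have hle : |b ^ (N + 1) * s| ≤ 1 := by
    rw [abs_mul, abs_zpow]
    calc _ ≤ |b| ^ (N + 1) * |b| ^ (-(N + 1)) := by gcongr
      _ = 1 := by rw [← zpow_add₀ hb0.ne', add_neg_cancel, zpow_zero]
  rw [e, hd.twoSided_zpow_mul, ← e, abs_mul, abs_of_pos (zpow_pos h0 _)]
  calc lam ^ (-(N + 1)) * |twoSided A lam p w (b ^ (N + 1) * s) (backward A (-(N + 1)) y)|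
      ≤ lam ^ (-(N + 1)) * K := by gcongr; exact hK _ hle _
    _ = K / lam * lam ^ (-N) := by
        rw [neg_add, zpow_add₀ h0.ne', zpow_neg_one]; ring
    _ = K / lam * (|b| ^ (-N)) ^ holderExp lam b := by rw [hd.zpow_rpow_holderExp]
    _ ≤ _ := by gcongr

end SkewSlice

/-! ### Mean values along lines, uniqueness of Fourier coefficients, Kronecker's theorem. -/

namespace SkewSlice

variable {k : ℕ}

/-- The mean of `h` over `[-T, T]`. -/
noncomputable def symMean (h : ℝ → ℂ) (T : ℝ) : ℂ := (1 / (2 * (T : ℂ))) * ∫ t in (-T)..T, h t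

/-- `c` is the mean value of `h` over the real line. -/
def HasMean (h : ℝ → ℂ) (c : ℂ) : Prop := Tendsto (symMean h) atTop (𝓝 c)

theorem norm_symMean_le {h : ℝ → ℂ} {C : ℝ} (hC : ∀ t, ‖h t‖ ≤ C) {T : ℝ} (hT : 0 < T) :
    ‖symMean h T‖ ≤ C := by
  have := intervalIntegral.norm_integral_le_of_norm_le_const (a := -T) (b := T) (f := h)
    (fun t _ => hC t)
  rw [symMean, norm_mul]
  have e : ‖1 / (2 * (T : ℂ))‖ = 1 / (2 * T) := by
    simp [abs_of_pos hT]
  have e' : |T - -T| = 2 * T := by rw [sub_neg_eq_add, ← two_mul, abs_of_pos (by positivity)]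
  rw [e]
  rw [e'] at this
  calc _ ≤ 1 / (2 * T) * (C * (2 * T)) := by gcongr
    _ = C := by field_simp

theorem symMean_sub {h g : ℝ → ℂ} (hh : Continuous h) (hg : Continuous g) (T : ℝ) :
    symMean (fun t => h t - g t) T = symMean h T - symMean g T := by
  rw [symMean, intervalIntegral.integral_sub (hh.intervalIntegrable _ _)
    (hg.intervalIntegrable _ _), mul_sub]; rfl

theorem HasMean.const_mul {h : ℝ → ℂ} {c : ℂ} (hc : HasMean h c) (a : ℂ) :
    HasMean (fun t => a * h t) (a * c) := by
  refine (Tendsto.const_mul a hc).congr fun T => ?_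
  rw [symMean, symMean, intervalIntegral.integral_const_mul]; ring

theorem HasMean.sub {h g : ℝ → ℂ} {c d : ℂ} (hh : Continuous h) (hg : Continuous g)
    (hc : HasMean h c) (hd : HasMean g d) : HasMean (fun t => h t - g t) (c - d) :=
  (Tendsto.sub hc hd).congr fun T => (symMean_sub hh hg T).symm

theorem HasMean.add {h g : ℝ → ℂ} {c d : ℂ} (hh : Continuous h) (hg : Continuous g)
    (hc : HasMean h c) (hd : HasMean g d) : HasMean (fun t => h t + g t) (c + d) := by
  refine (Tendsto.add hc hd).congr fun T => ?_
  rw [symMean, symMean, symMean, intervalIntegral.integral_add (hh.intervalIntegrable _ _)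
    (hg.intervalIntegrable _ _), mul_add]

theorem HasMean.unique {h : ℝ → ℂ} {c d : ℂ} (hc : HasMean h c) (hd : HasMean h d) : c = d :=
  tendsto_nhds_unique hc hd

theorem hasMean_const (c : ℂ) : HasMean (fun _ => c) c := by
  refine tendsto_const_nhds.congr' ?_
  filter_upwards [eventually_gt_atTop 0] with T hT
  have : (T : ℂ) ≠ 0 := by exact_mod_cast hT.ne'
  rw [symMean, intervalIntegral.integral_const]
  simp
  field_simp
  norm_num

theorem hasMean_exp {a : ℝ} (ha : a ≠ 0) :
    HasMean (fun t : ℝ => Complex.exp (Complex.I * a * t)) 0 := by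
  have hc : Complex.I * (a : ℂ) ≠ 0 := mul_ne_zero Complex.I_ne_zero (by exact_mod_cast ha)
  have hnorm : ∀ t : ℝ, ‖Complex.exp (Complex.I * a * t)‖ = 1 := fun t => by
    rw [show Complex.I * (a : ℂ) * t = ((a * t : ℝ) : ℂ) * Complex.I by push_cast; ring]
    exact Complex.norm_exp_ofReal_mul_I _
  have hb : ∀ T : ℝ, 0 < T → ‖symMean (fun t : ℝ => Complex.exp (Complex.I * a * t)) T‖ ≤
      (1 / |a|) * T⁻¹ := by
    intro T hT
    rw [symMean, integral_exp_mul_complex hc, norm_mul, norm_div, norm_div, norm_mul, norm_mul]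
    have h2 : ‖Complex.exp (Complex.I * a * T) - Complex.exp (Complex.I * a * ((-T : ℝ) : ℂ))‖ ≤ 2 := by
      refine (norm_sub_le _ _).trans ?_
      rw [hnorm, hnorm]; norm_num
    simp only [norm_one, Complex.norm_I, one_mul, Complex.norm_real, Real.norm_eq_abs,
      abs_of_pos hT, Complex.norm_ofNat]
    calc _ ≤ 1 / (2 * T) * (2 / |a|) := by gcongr
      _ = _ := by field_simp
  refine squeeze_zero_norm' (a := fun T : ℝ => (1 / |a|) * T⁻¹) ?_ ?_
  · filter_upwards [eventually_gt_atTop 0] with T hT using hb T hT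
  · simpa using tendsto_inv_atTop_zero.const_mul (1 / |a|)

theorem hasMean_of_approx {h : ℝ → ℂ} {c : ℂ} (hh : Continuous h)
    (happ : ∀ ε > 0, ∃ g d, Continuous g ∧ HasMean g d ∧ (∀ t, ‖h t - g t‖ ≤ ε) ∧ ‖d - c‖ ≤ ε) :
    HasMean h c := by
  refine Metric.tendsto_atTop.2 fun ε hε => ?_
  obtain ⟨g, d, hg, hd, h1, h2⟩ := happ (ε / 4) (by positivity)
  obtain ⟨T₀, hT₀⟩ := Metric.tendsto_atTop.1 hd (ε / 4) (by positivity)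
  refine ⟨max T₀ 1, fun T hT => ?_⟩
  have a1 := hT₀ T ((le_max_left _ _).trans hT)
  have a2 := norm_symMean_le h1 (T := T) (by linarith [le_max_right T₀ 1])
  rw [symMean_sub hh hg] at a2
  rw [dist_eq_norm] at a1 ⊢
  calc _ = ‖(symMean h T - symMean g T) + (symMean g T - d) + (d - c)‖ := by congr 1; ring
    _ ≤ _ := norm_add₃_le
    _ < ε := by linarith

theorem exists_hasMean_of_approx {h : ℝ → ℂ} (hh : Continuous h)
    (happ : ∀ ε > 0, ∃ g d, Continuous g ∧ HasMean g d ∧ ∀ t, ‖h t - g t‖ ≤ ε) :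
    ∃ c, HasMean h c := by
  refine cauchySeq_tendsto_of_complete (Metric.cauchySeq_iff'.2 fun ε hε => ?_)
  obtain ⟨g, d, hg, hd, h1⟩ := happ (ε / 8) (by positivity)
  obtain ⟨T₀, hT₀⟩ := Metric.tendsto_atTop.1 hd (ε / 8) (by positivity)
  have key : ∀ T ≥ max T₀ 1, ‖symMean h T - d‖ ≤ ε / 4 := fun T hT => by
    have a1 := hT₀ T ((le_max_left _ _).trans hT)
    have a2 := norm_symMean_le h1 (T := T) (by linarith [le_max_right T₀ 1])
    rw [symMean_sub hh hg] at a2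
    rw [dist_eq_norm] at a1
    calc _ = ‖(symMean h T - symMean g T) + (symMean g T - d)‖ := by congr 1; ring
      _ ≤ _ := norm_add_le _ _
      _ ≤ _ := by linarith
  refine ⟨max T₀ 1, fun T hT => ?_⟩
  have b1 := key T hT
  have b2 := key _ le_rfl
  rw [dist_eq_norm]
  calc _ = ‖(symMean h T - d) - (symMean h (max T₀ 1) - d)‖ := by congr 1; ring
    _ ≤ _ := norm_sub_le _ _
    _ < ε := by linarith

theorem HasMean.comp_mul {h : ℝ → ℂ} {c : ℂ} (hc : HasMean h c) {a : ℝ} (ha : a ≠ 0) :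
    HasMean (fun t => h (a * t)) c := by
  have e : ∀ T, symMean (fun t => h (a * t)) T = symMean h (|a| * T) := fun T => by
    have ha' : (a : ℂ) ≠ 0 := by exact_mod_cast ha
    rw [symMean, intervalIntegral.integral_comp_mul_left _ ha, symMean]
    rcases abs_cases a with ⟨h1, -⟩ | ⟨h1, -⟩ <;> rw [h1]
    · rw [Complex.real_smul]
      push_cast
      rw [mul_neg]
      rcases eq_or_ne (T : ℂ) 0 with h0 | h0
      · simp [h0]
      · field_simp
    · rw [Complex.real_smul, neg_mul, neg_neg, mul_neg, intervalIntegral.integral_symm]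
      push_cast
      rcases eq_or_ne (T : ℂ) 0 with h0 | h0
      · simp [h0]
      · field_simp
  refine Tendsto.congr (fun T => (e T).symm) (Tendsto.comp hc ?_)
  exact tendsto_id.const_mul_atTop (abs_pos.2 ha)

/-- The windows `[-T, T]` and `[-T + s, T + s]` differ by two intervals of length `|s|`, negligible
after division by `2T`. -/
theorem HasMean.comp_add {h : ℝ → ℂ} {c : ℂ} (hc : HasMean h c) (hh : Continuous h) {C : ℝ}
    (hC : ∀ t, ‖h t‖ ≤ C) (s : ℝ) : HasMean (fun t => h (t + s)) c := by
  have hi : ∀ a b, IntervalIntegrable h volume a b := fun a b => hh.intervalIntegrable a b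
  have hb : ∀ T : ℝ, 0 < T → ‖symMean (fun t => h (t + s)) T - symMean h T‖ ≤ (C * |s|) * T⁻¹ := by
    intro T hT
    rw [symMean, symMean, ← mul_sub, intervalIntegral.integral_comp_add_right,
      intervalIntegral.integral_interval_sub_interval_comm (hi _ _) (hi _ _) (hi _ _), norm_mul]
    have h1 := intervalIntegral.norm_integral_le_of_norm_le_const (a := -T + s) (b := -T) (f := h)
      (fun t _ => hC t)
    have h2 := intervalIntegral.norm_integral_le_of_norm_le_const (a := T + s) (b := T) (f := h)
      (fun t _ => hC t)
    have h3 := norm_sub_le (∫ t in (-T + s)..(-T), h t) (∫ t in (T + s)..T, h t)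
    have e1 : |-T - (-T + s)| = |s| := by rw [← abs_neg]; congr 1; ring
    have e2 : |T - (T + s)| = |s| := by rw [← abs_neg]; congr 1; ring
    rw [e1] at h1
    rw [e2] at h2
    have e : ‖1 / (2 * (T : ℂ))‖ = 1 / (2 * T) := by simp [abs_of_pos hT]
    rw [e]
    calc _ ≤ 1 / (2 * T) * (2 * (C * |s|)) := by gcongr; linarith
      _ = _ := by field_simp
  have h0 : Tendsto (fun T => symMean (fun t => h (t + s)) T - symMean h T) atTop (𝓝 0) := by
    refine squeeze_zero_norm' (a := fun T : ℝ => (C * |s|) * T⁻¹) ?_ ?_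
    · filter_upwards [eventually_gt_atTop 0] with T hT using hb T hT
    · simpa using tendsto_inv_atTop_zero.const_mul (C * |s|)
  simpa [HasMean] using h0.add hc

/-- Dominated convergence is used twice: to exchange sum and integral for fixed `T`, and then sum
and limit in `T`. -/
theorem hasMean_tsum {ι : Type*} [Countable ι] {f : ι → ℝ → ℂ} {c : ι → ℂ} {u : ι → ℝ}
    (hu : Summable u)
    (hf : ∀ n, Continuous (f n)) (hfu : ∀ n t, ‖f n t‖ ≤ u n) (hc : ∀ n, HasMean (f n) (c n)) :
    HasMean (fun t => ∑' n, f n t) (∑' n, c n) := by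
  have e : ∀ T, symMean (fun t => ∑' n, f n t) T = ∑' n, symMean (f n) T := fun T => by
    have := intervalIntegral.hasSum_integral_of_dominated_convergence (μ := volume) (a := -T)
      (b := T) (F := f) (f := fun t => ∑' n, f n t) (fun n _ => u n)
      (fun n => (hf n).aestronglyMeasurable) (fun n => .of_forall fun t _ => hfu n t)
      (.of_forall fun t _ => hu) intervalIntegrable_const
      (.of_forall fun t _ => (Summable.of_norm_bounded hu fun n => hfu n t).hasSum)
    simp only [symMean]
    rw [← this.tsum_eq, tsum_mul_left]
  refine Tendsto.congr (fun T => (e T).symm) ?_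
  refine tendsto_tsum_of_dominated_convergence hu hc ?_
  filter_upwards [eventually_gt_atTop 0] with T hT n using norm_symMean_le (hfu n) hT

section Torus

open UnitAddTorus

theorem exists_span_mFourier_approx (F : C(UnitAddTorus (Fin k), ℂ)) {ε : ℝ} (hε : 0 < ε) :
    ∃ P ∈ Submodule.span ℂ (Set.range (mFourier (d := Fin k))), ∀ y, ‖F y - P y‖ ≤ ε := by
  have hF : F ∈ (Submodule.span ℂ (Set.range (mFourier (d := Fin k)))).topologicalClosure := by
    rw [span_mFourier_closure_eq_top]; trivial
  obtain ⟨P, hP, hd⟩ := Metric.mem_closure_iff.1 hF ε hε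
  refine ⟨P, hP, fun y => ?_⟩
  rw [← dist_eq_norm]
  exact (ContinuousMap.dist_apply_le_dist y).trans hd.le

/-- The frequency of the character `m` along the direction `w`. -/
noncomputable def charFreq (w : Fin k → ℝ) (m : Fin k → ℤ) : ℝ := 2 * Real.pi * ∑ i, m i * w i

theorem mFourier_add_line (m : Fin k → ℤ) (y : UnitAddTorus (Fin k)) (w : Fin k → ℝ) (t : ℝ) :
    mFourier m (y + line w t) = mFourier m y * Complex.exp (Complex.I * charFreq w m * t) := by
  have h1 : ∀ i, fourier (m i) ((y + line w t) i) =
      fourier (m i) (y i) * Complex.exp (2 * Real.pi * Complex.I * m i * (t * w i)) := fun i => by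
    have : (y + line w t) i = y i + ((t * w i : ℝ) : UnitAddCircle) := rfl
    rw [this, fourier_apply, smul_add, AddCircle.toCircle_add, Circle.coe_mul, ← fourier_apply,
      ← fourier_apply, fourier_coe_apply]
    congr 2
    push_cast
    ring
  simp only [mFourier, ContinuousMap.coe_mk]
  rw [Finset.prod_congr rfl fun i _ => h1 i, Finset.prod_mul_distrib, ← Complex.exp_sum]
  congr 2
  rw [charFreq]
  push_cast
  rw [Finset.mul_sum, Finset.mul_sum, Finset.sum_mul]
  refine Finset.sum_congr rfl fun i _ => ?_
  ring

/-- A character restricted to a line is an exponential, whose twisted mean exists; uniform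
approximation by trigonometric polynomials extends this to continuous functions. -/
theorem exists_hasMean_line (F : C(UnitAddTorus (Fin k), ℂ)) (y : UnitAddTorus (Fin k))
    (w : Fin k → ℝ) (a : ℝ) :
    ∃ c, HasMean (fun t : ℝ => F (y + line w t) * Complex.exp (-(Complex.I * a * t))) c := by
  have hline := continuous_line w
  have hcont : ∀ P : C(UnitAddTorus (Fin k), ℂ), Continuous
      fun t : ℝ => P (y + line w t) * Complex.exp (-(Complex.I * a * t)) := fun P => by fun_prop
  have hnorm : ∀ t : ℝ, ‖Complex.exp (-(Complex.I * a * t))‖ = 1 := fun t => by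
    rw [show -(Complex.I * (a : ℂ) * t) = ((-(a * t) : ℝ) : ℂ) * Complex.I by push_cast; ring]
    exact Complex.norm_exp_ofReal_mul_I _
  refine exists_hasMean_of_approx (hcont F) fun ε hε => ?_
  obtain ⟨P, hP, hPε⟩ := exists_span_mFourier_approx F hε
  have hex : ∃ c, HasMean (fun t : ℝ => P (y + line w t) * Complex.exp (-(Complex.I * a * t))) c := by
    clear hPε
    induction hP using Submodule.span_induction with
    | mem P hP =>
      obtain ⟨m, rfl⟩ := hP
      have e : (fun t : ℝ => mFourier m (y + line w t) * Complex.exp (-(Complex.I * a * t))) =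
          fun t : ℝ => mFourier m y *
            Complex.exp (Complex.I * ((charFreq w m - a : ℝ) : ℂ) * t) := by
        funext t
        rw [mFourier_add_line, mul_assoc, ← Complex.exp_add]
        congr 2
        push_cast; ring
      rw [e]
      rcases eq_or_ne (charFreq w m - a) 0 with h0 | h0
      · exact ⟨mFourier m y, by simpa [h0] using hasMean_const (mFourier m y)⟩
      · exact ⟨_, (hasMean_exp h0).const_mul _⟩
    | zero => exact ⟨0, by simpa using hasMean_const 0⟩
    | add P Q _ _ hP hQ =>
      obtain ⟨c, hc⟩ := hP
      obtain ⟨d, hd⟩ := hQ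
      exact ⟨c + d, by simpa [add_mul] using hc.add (hcont P) (hcont Q) hd⟩
    | smul z P _ hP =>
      obtain ⟨c, hc⟩ := hP
      exact ⟨z * c, by simpa [mul_assoc] using hc.const_mul z⟩
  obtain ⟨c, hc⟩ := hex
  refine ⟨_, c, hcont P, hc, fun t => ?_⟩
  rw [← sub_mul, norm_mul, hnorm, mul_one]
  exact hPε _

theorem line_mem_closure_add {w : Fin k → ℝ} {z : UnitAddTorus (Fin k)}
    (hz : z ∈ closure (Set.range (line w))) (t : ℝ) : z + line w t ∈ closure (Set.range (line w)) := by
  refine map_mem_closure (f := fun z => z + line w t) (by fun_prop) hz ?_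
  rintro _ ⟨s, rfl⟩
  exact ⟨s + t, line_add w s t⟩

/-- Along a line in the torus the integral of a nonnegative continuous function which is positive
at a point `x₀` grows linearly, uniformly over the starting points in the orbit closure of `x₀`. -/
theorem exists_linear_growth {f : UnitAddTorus (Fin k) → ℝ} (hf : Continuous f)
    (hf0 : ∀ y, 0 ≤ f y) {x₀ : UnitAddTorus (Fin k)} (hx₀ : 0 < f x₀) (w : Fin k → ℝ) :
    ∃ c R₀ : ℝ, 0 < c ∧ 0 < R₀ ∧ ∀ y, y - x₀ ∈ closure (Set.range (line w)) → ∀ R, R₀ ≤ R →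
      c * R ≤ ∫ u in (-R)..R, f (y + line w u) := by
  have hline := continuous_line w
  have hint : ∀ y a b, IntervalIntegrable (fun u => f (y + line w u)) volume a b := fun y a b =>
    Continuous.intervalIntegrable (by fun_prop) a b
  obtain ⟨ε, hε, hball⟩ := Metric.eventually_nhds_iff.1
    (hf.continuousAt.eventually (lt_mem_nhds (half_lt_self hx₀)))
  -- Compactness of the orbit closure bounds the time needed to come close to `x₀`, uniformly in the
  -- starting point.
  obtain ⟨S, hS⟩ := (isClosed_closure (s := Set.range (line w))).isCompact.elim_finite_subcover
    (fun t : ℝ => Metric.ball (line w t) (ε / 2)) (fun _ => Metric.isOpen_ball) (by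
      intro z hz
      obtain ⟨_, ⟨t, rfl⟩, ht⟩ := Metric.mem_closure_iff.1 hz (ε / 2) (by positivity)
      exact Set.mem_iUnion.2 ⟨t, ht⟩)
  obtain ⟨L, hL⟩ := (S.image fun t => |t|).bddAbove
  have hL' : ∀ t ∈ S, |t| ≤ L := fun t ht => hL (by simpa using ⟨t, ht, rfl⟩)
  set η : ℝ := ε / (2 * (‖w‖ + 1)) with hη
  have hη0 : 0 < η := by positivity
  set D : ℝ := |L| + η with hD
  have hD0 : 0 < D := by positivity
  -- Every window of half-length `D` contains an interval of length `2η` on which `f ≥ f x₀ / 2`.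
  have hstep : ∀ y, y - x₀ ∈ closure (Set.range (line w)) →
      η * f x₀ ≤ ∫ u in (-D)..D, f (y + line w u) := by
    intro y hy
    obtain ⟨t, ht, hyt⟩ := Set.mem_iUnion₂.1 (hS hy)
    have ht1 := hL' t ht
    have ht2 := (abs_le.1 (ht1.trans (le_abs_self L)))
    have h1 : ∫ u in (-t - η)..(-t + η), f (y + line w u) ≤ ∫ u in (-D)..D, f (y + line w u) :=
      intervalIntegral.integral_mono_interval (by linarith) (by linarith) (by linarith)
        (.of_forall fun u => hf0 _) (hint _ _ _)
    refine le_trans ?_ h1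
    have h2 : ∫ _ in (-t - η)..(-t + η), f x₀ / 2 ≤ ∫ u in (-t - η)..(-t + η), f (y + line w u) := by
      refine intervalIntegral.integral_mono_on_of_le_Ioo (by linarith) intervalIntegrable_const
        (hint _ _ _) fun u hu => (hball ?_).le
      have e : y + line w u - x₀ = (y - x₀ - line w t) + line w (t + u) := by
        rw [line_add]; abel
      rw [dist_eq_norm, e]
      rw [Metric.mem_ball, dist_eq_norm] at hyt
      have hn := norm_line_le w (t + u)
      have hu' : |t + u| < η := abs_lt.2 ⟨by linarith [hu.1], by linarith [hu.2]⟩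
      have : |t + u| * ‖w‖ ≤ η * (‖w‖ + 1) := by
        have := norm_nonneg w
        gcongr; linarith
      have e2 : η * (‖w‖ + 1) = ε / 2 := by rw [hη]; have := norm_nonneg w; field_simp
      linarith [norm_add_le (y - x₀ - line w t) (line w (t + u))]
    refine le_trans (le_of_eq ?_) h2
    rw [intervalIntegral.integral_const, smul_eq_mul]; ring
  have hmany : ∀ n : ℕ, ∀ y, y - x₀ ∈ closure (Set.range (line w)) →
      n * (η * f x₀) ≤ ∫ u in (0 : ℝ)..(2 * D * n), f (y + line w u) := by
    intro n
    induction n with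
    | zero => intro y _; simp
    | succ n ih =>
      intro y hy
      have hmem : ∀ t, y + line w t - x₀ ∈ closure (Set.range (line w)) := fun t => by
        have := line_mem_closure_add hy t
        rwa [sub_add_eq_add_sub] at this
      have h1 := hstep _ (hmem D)
      have h2 := ih _ (hmem (2 * D))
      have e1 : ∫ u in (0 : ℝ)..(2 * D), f (y + line w u) =
          ∫ u in (-D)..D, f (y + line w D + line w u) := by
        have := intervalIntegral.integral_comp_add_left (a := -D) (b := D)
          (fun u => f (y + line w u)) D
        simp only [line_add, ← add_assoc] at this
        rw [this]
        congr 1 <;> ring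
      have e2 : ∫ u in (2 * D)..(2 * D * (n + 1 : ℕ)), f (y + line w u) =
          ∫ u in (0 : ℝ)..(2 * D * n), f (y + line w (2 * D) + line w u) := by
        have := intervalIntegral.integral_comp_add_left (a := 0) (b := 2 * D * n)
          (fun u => f (y + line w u)) (2 * D)
        simp only [line_add, ← add_assoc] at this
        rw [this]
        congr 1 <;> push_cast <;> ring
      rw [← intervalIntegral.integral_add_adjacent_intervals (hint y 0 (2 * D)) (hint y _ _), e1, e2]
      push_cast
      linarith
  refine ⟨η * f x₀ / (2 * D), 2 * D, by positivity, by positivity, fun y hy R hR => ?_⟩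
  have hmem : y + line w (-R) - x₀ ∈ closure (Set.range (line w)) := by
    have := line_mem_closure_add hy (-R)
    rwa [sub_add_eq_add_sub] at this
  have h1 := hmany ⌊R / D⌋₊ _ hmem
  have hfl := Nat.lt_floor_add_one (R / D)
  have hfl2 := Nat.floor_le (a := R / D) (div_nonneg (by linarith) hD0.le)
  have e1 : ∫ u in (-R)..R, f (y + line w u) =
      ∫ u in (0 : ℝ)..(2 * R), f (y + line w (-R) + line w u) := by
    have := intervalIntegral.integral_comp_add_left (a := 0) (b := 2 * R)
      (fun u => f (y + line w u)) (-R)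
    simp only [line_add, ← add_assoc] at this
    rw [this]
    congr 1 <;> ring
  rw [e1]
  have h2 : ∫ u in (0 : ℝ)..(2 * D * (⌊R / D⌋₊ : ℕ)), f (y + line w (-R) + line w u) ≤
      ∫ u in (0 : ℝ)..(2 * R), f (y + line w (-R) + line w u) := by
    refine intervalIntegral.integral_mono_interval le_rfl (by positivity) ?_
      (.of_forall fun u => hf0 _) (hint _ _ _)
    rw [le_div_iff₀ hD0] at hfl2
    linarith
  refine le_trans ?_ (h1.trans h2)
  have h3 : R / (2 * D) ≤ ⌊R / D⌋₊ := by
    have : 2 ≤ R / D := by rw [le_div_iff₀ hD0]; exact hR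
    have e : R / (2 * D) = (R / D) / 2 := by field_simp
    rw [e]; linarith
  calc _ = R / (2 * D) * (η * f x₀) := by ring
    _ ≤ _ := by gcongr

/-- A continuous function on the torus all of whose Fourier coefficients at nonzero frequencies
along a line vanish is constant on the line. -/
theorem eq_const_of_hasMean_zero {F : UnitAddTorus (Fin k) → ℝ} (hF : Continuous F)
    (x : UnitAddTorus (Fin k)) (w : Fin k → ℝ)
    (h0 : ∀ σ : ℝ, σ ≠ 0 → HasMean (fun t : ℝ => (F (x + line w t) : ℂ) *
      Complex.exp (-(Complex.I * σ * t))) 0) (t : ℝ) : F (x + line w t) = F x := by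
  have hline := continuous_line w
  obtain ⟨c, hc⟩ := exists_hasMean_line ⟨fun y => (F y : ℂ), by fun_prop⟩ x w 0
  -- With its mean subtracted, the function has no nonzero coefficient at any frequency, zero
  -- included.
  set H : C(UnitAddTorus (Fin k), ℂ) := ⟨fun y => (F y : ℂ) - c, by fun_prop⟩ with hH
  obtain ⟨C, hC⟩ : ∃ C : ℝ, ∀ y, ‖H y‖ ≤ C := ⟨‖H‖, H.norm_coe_le_norm⟩
  have hC0 : 0 ≤ C := (norm_nonneg _).trans (hC 0)
  have hall : ∀ a : ℝ, HasMean (fun t : ℝ => H (x + line w t) * Complex.exp (Complex.I * a * t)) 0 := by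
    intro a
    have e : (fun t : ℝ => H (x + line w t) * Complex.exp (Complex.I * a * t)) = fun t : ℝ =>
        (F (x + line w t) : ℂ) * Complex.exp (-(Complex.I * ((-a : ℝ) : ℂ) * t)) -
          c * Complex.exp (Complex.I * a * t) := by
      funext t
      simp only [hH, ContinuousMap.coe_mk, sub_mul]
      congr 3
      push_cast; ring
    rw [e]
    rcases eq_or_ne a 0 with rfl | ha
    · simp only [ContinuousMap.coe_mk] at hc
      have := hc.sub (by fun_prop) (by fun_prop) (hasMean_const c)
      simpa using this
    · have := (h0 (-a) (neg_ne_zero.2 ha)).sub (by fun_prop) (by fun_prop)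
        ((hasMean_exp ha).const_mul c)
      simpa using this
  have hspan : ∀ P ∈ Submodule.span ℂ (Set.range (mFourier (d := Fin k))),
      HasMean (fun t : ℝ => H (x + line w t) * P (x + line w t)) 0 := by
    intro P hP
    induction hP using Submodule.span_induction with
    | mem P hP =>
      obtain ⟨m, rfl⟩ := hP
      have := (hall (charFreq w m)).const_mul (mFourier m x)
      rw [mul_zero] at this
      convert this using 2 with t
      rw [mFourier_add_line]; ring
    | zero => simpa using hasMean_const 0
    | add P Q _ _ hP hQ =>
      have := hP.add (by fun_prop) (by fun_prop) hQ
      simpa [mul_add] using this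
    | smul z P _ hP =>
      have := hP.const_mul z
      simpa [mul_left_comm] using this
  -- Approximating the conjugate of `H` by trigonometric polynomials shows that `|H|²` has mean zero
  -- on the line; linear growth of its integral then excludes any point of the line where `H ≠ 0`.
  have hsq : HasMean (fun t : ℝ => ((‖H (x + line w t)‖ ^ 2 : ℝ) : ℂ)) 0 := by
    refine hasMean_of_approx (by fun_prop) fun ε hε => ?_
    obtain ⟨P, hP, hPε⟩ := exists_span_mFourier_approx (star H) (ε := ε / (C + 1)) (by positivity)
    refine ⟨_, 0, by fun_prop, hspan P hP, fun t => ?_, by simpa using hε.le⟩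
    rw [Complex.ofReal_pow, ← Complex.mul_conj', ← mul_sub, norm_mul]
    calc _ ≤ C * (ε / (C + 1)) := by
          gcongr
          · exact hC _
          · exact hPε _
      _ ≤ (C + 1) * (ε / (C + 1)) := by gcongr; linarith
      _ = ε := by field_simp
  have hzero : ∀ t, H (x + line w t) = 0 := by
    intro t
    by_contra hne
    obtain ⟨c', R₀, hc', hR₀, hgrow⟩ := exists_linear_growth (f := fun y => ‖H y‖ ^ 2) (by fun_prop)
      (fun y => by positivity) (x₀ := x + line w t) (pow_pos (norm_pos_iff.2 hne) 2) w
    have hx : x - (x + line w t) ∈ closure (Set.range (line w)) := by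
      refine subset_closure ⟨-t, ?_⟩
      rw [line_neg]; abel
    obtain ⟨T₀, hT₀⟩ := Metric.tendsto_atTop.1 hsq (c' / 2) (by positivity)
    have hT := hT₀ (max T₀ R₀) (le_max_left _ _)
    have hg := hgrow x hx (max T₀ R₀) (le_max_right _ _)
    set T := max T₀ R₀
    have hTpos : 0 < T := hR₀.trans_le (le_max_right _ _)
    have e : symMean (fun t : ℝ => ((‖H (x + line w t)‖ ^ 2 : ℝ) : ℂ)) T =
        ((1 / (2 * T) * ∫ u in (-T)..T, ‖H (x + line w u)‖ ^ 2 : ℝ) : ℂ) := by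
      rw [symMean, intervalIntegral.integral_ofReal]
      push_cast; rfl
    rw [e, dist_zero_right, Complex.norm_real, Real.norm_eq_abs] at hT
    have h1 := (le_abs_self _).trans_lt hT
    have h2 : 1 / (2 * T) * (c' * T) ≤ 1 / (2 * T) * ∫ u in (-T)..T, ‖H (x + line w u)‖ ^ 2 := by
      gcongr
    have h3 : 1 / (2 * T) * (c' * T) = c' / 2 := by field_simp
    linarith
  have h1 := hzero t
  have h2 := hzero 0
  rw [line_zero, add_zero] at h2
  have h3 : (F (x + line w t) : ℂ) = F x := by
    simp only [hH, ContinuousMap.coe_mk] at h1 h2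
    rw [sub_eq_zero.1 h1, sub_eq_zero.1 h2]
  exact_mod_cast h3

instance isProbabilityMeasure_volume :
    IsProbabilityMeasure (volume : Measure (UnitAddTorus (Fin k))) := by
  have : IsProbabilityMeasure (volume : Measure UnitAddCircle) := ⟨UnitAddCircle.measure_univ⟩
  exact inferInstanceAs (IsProbabilityMeasure (Measure.pi fun _ : Fin k => volume))

/-- Translating by `π / charFreq w m` along the line multiplies the character by `-1` and leaves its
integral unchanged. -/
theorem integral_mFourier_eq_zero {w : Fin k → ℝ} {m : Fin k → ℤ} (hm : charFreq w m ≠ 0) :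
    ∫ y, mFourier m y = 0 := by
  have h1 : ∀ t : ℝ, ∫ y, mFourier m y = (∫ y, mFourier m y) *
      Complex.exp (Complex.I * charFreq w m * t) := fun t => by
    conv_lhs => rw [← integral_add_right_eq_self _ (line w t)]
    simp only [mFourier_add_line]
    exact integral_mul_const _ _
  have h2 := h1 (Real.pi / charFreq w m)
  have e : Complex.I * (charFreq w m : ℂ) * ((Real.pi / charFreq w m : ℝ) : ℂ) =
      Real.pi * Complex.I := by
    have : (charFreq w m : ℂ) ≠ 0 := by exact_mod_cast hm
    push_cast
    field_simp
  rw [e, Complex.exp_pi_mul_I] at h2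
  linear_combination h2 / 2

/-- Kronecker's theorem: a line whose direction has rationally independent coordinates is dense
in the torus. -/
theorem dense_line {w : Fin k → ℝ} (hw : ∀ m : Fin k → ℤ, m ≠ 0 → ∑ i, (m i : ℝ) * w i ≠ 0) :
    closure (Set.range (line w)) = Set.univ := by
  have hline := continuous_line w
  have hweyl : ∀ F : C(UnitAddTorus (Fin k), ℂ), HasMean (fun t => F (line w t)) (∫ y, F y) := by
    have hfreq : ∀ m : Fin k → ℤ, m ≠ 0 → charFreq w m ≠ 0 := fun m hm =>
      mul_ne_zero (by positivity) (hw m hm)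
    have hintg : ∀ F : C(UnitAddTorus (Fin k), ℂ), Integrable F volume := fun F =>
      F.continuous.integrable_of_hasCompactSupport (HasCompactSupport.of_compactSpace F)
    have hspan : ∀ P ∈ Submodule.span ℂ (Set.range (mFourier (d := Fin k))),
        HasMean (fun t => P (line w t)) (∫ y, P y) := by
      intro P hP
      induction hP using Submodule.span_induction with
      | mem P hP =>
        obtain ⟨m, rfl⟩ := hP
        rcases eq_or_ne m 0 with rfl | hm
        · simpa [mFourier_zero] using hasMean_const 1
        · rw [integral_mFourier_eq_zero (hfreq m hm)]
          have := (hasMean_exp (hfreq m hm)).const_mul (mFourier m 0)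
          simpa only [← mFourier_add_line, mul_zero, zero_add] using this
      | zero => simpa using hasMean_const 0
      | add P Q _ _ hP hQ =>
        have := hP.add (by fun_prop) (by fun_prop) hQ
        rw [← integral_add (hintg P) (hintg Q)] at this
        exact this
      | smul z P _ hP =>
        have := hP.const_mul z
        rw [← integral_const_mul] at this
        exact this
    intro F
    refine hasMean_of_approx (by fun_prop) fun ε hε => ?_
    obtain ⟨P, hP, hPε⟩ := exists_span_mFourier_approx F hε
    refine ⟨_, _, by fun_prop, hspan P hP, fun t => hPε _, ?_⟩
    rw [← integral_sub (hintg P) (hintg F)]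
    refine (norm_integral_le_of_norm_le_const (C := ε) (.of_forall fun y => ?_)).trans ?_
    · rw [norm_sub_rev]; exact hPε y
    · simp
  -- The distance to the orbit closure vanishes on the line, so equidistribution makes its integral
  -- zero; being continuous and nonnegative, it vanishes everywhere.
  have h1 := hweyl ⟨fun y => ((Metric.infDist y (closure (Set.range (line w))) : ℝ) : ℂ), by fun_prop⟩
  have h2 : (fun t => ((Metric.infDist (line w t) (closure (Set.range (line w))) : ℝ) : ℂ)) =
      fun _ => 0 := by
    funext t
    rw [Metric.infDist_zero_of_mem (subset_closure (Set.mem_range_self t))]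
    rfl
  simp only [ContinuousMap.coe_mk] at h1
  rw [h2] at h1
  have h3 := (hasMean_const 0).unique h1
  rw [integral_complex_ofReal] at h3
  have h4 : ∫ y, Metric.infDist y (closure (Set.range (line w))) = 0 := by exact_mod_cast h3.symm
  have hc : Continuous fun y => Metric.infDist y (closure (Set.range (line w))) := by fun_prop
  rw [integral_eq_zero_iff_of_nonneg (fun y => Metric.infDist_nonneg)
    (hc.integrable_of_hasCompactSupport (HasCompactSupport.of_compactSpace _)),
    Continuous.ae_eq_iff_eq volume hc continuous_zero] at h4
  refine Set.eq_univ_of_forall fun y => ?_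
  exact (isClosed_closure.mem_iff_infDist_zero (Set.range_nonempty _).closure).2 (congrFun h4 y)

end Torus

end SkewSlice

/-! ### Vanishing of the two-sided series in terms of Fourier coefficients; irreducibility. -/

namespace SkewSlice

variable {k : ℕ} {A : GL (Fin k) ℤ} {lam b : ℝ} {w : Fin k → ℝ} {p : UnitAddTorus (Fin k) → ℝ}

/-- The limit in the definition of `bohrCoeff` exists, so `limUnder` does not return a junk value.
-/
theorem hasMean_bohrCoeff (hp : Continuous p) (y : UnitAddTorus (Fin k)) (w : Fin k → ℝ) (a : ℝ) :
    HasMean (fun t : ℝ => (p (y + line w t) : ℂ) * Complex.exp (-(Complex.I * a * t)))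
      (bohrCoeff (fun t => p (y + line w t)) a) := by
  obtain ⟨c, hc⟩ := exists_hasMean_line ⟨fun y => (p y : ℂ), by fun_prop⟩ y w a
  have : bohrCoeff (fun t => p (y + line w t)) a = c := Tendsto.limUnder_eq hc
  rw [this]
  exact hc

theorem norm_exp_neg_I_mul (a t : ℝ) : ‖Complex.exp (-(Complex.I * a * t))‖ = 1 := by
  rw [show -(Complex.I * (a : ℂ) * t) = ((-(a * t) : ℝ) : ℂ) * Complex.I by push_cast; ring]
  exact Complex.norm_exp_ofReal_mul_I _

/-- The Fourier coefficients of the increments of the two-sided series. -/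
theorem IsFractalDirection.hasMean_twoSided (hd : IsFractalDirection A lam b w)
    (hp : IsBoundedLipschitz p) (x : UnitAddTorus (Fin k)) (s σ : ℝ) :
    HasMean (fun t : ℝ => (twoSided A lam p w s (x + line w t) : ℂ) *
      Complex.exp (-(Complex.I * σ * t)))
      (gCoeff A lam p x b w σ * (Complex.exp (Complex.I * σ * s) - 1)) := by
  obtain ⟨M, hM0, hM⟩ := hp.bdd
  obtain ⟨u, hu, hu'⟩ := hd.exists_term_bound hp |s|
  have hpc := hp.cont
  have hline := continuous_line w
  have hterm : ∀ n : ℤ, HasMean (fun t : ℝ => (twoSidedTerm A lam p w s (x + line w t) n : ℂ) *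
      Complex.exp (-(Complex.I * σ * t))) ((lam : ℂ) ^ n *
        bohrCoeff (fun t : ℝ => p (toralMap (A ^ (-n)) x + torusProj (t • w))) (σ * b ^ n) *
        (Complex.exp (Complex.I * σ * s) - 1)) := by
    intro n
    -- The `n`-th term runs along the line at speed `b^(-n)`, which turns the frequency `σ b^n` into
    -- `σ`; the shift by `s` below produces the factor `e^{iσs}`.
    have h1 := (hasMean_bohrCoeff hp.cont (backward A n x) w (σ * b ^ n)).comp_mul
      (zpow_ne_zero (-n) hd.ne_zero)
    have e : ∀ t : ℝ, Complex.I * ((σ * b ^ n : ℝ) : ℂ) * ((b ^ (-n) * t : ℝ) : ℂ) =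
        Complex.I * σ * t := fun t => by
      rw [mul_assoc, ← Complex.ofReal_mul, show σ * b ^ n * (b ^ (-n) * t) = σ * t by
        rw [zpow_neg]; have := zpow_ne_zero n hd.ne_zero; field_simp]
      push_cast; ring
    simp only [e] at h1
    have h2 := (h1.comp_add (by fun_prop) (C := M) (fun t => by
      rw [norm_mul, norm_exp_neg_I_mul, mul_one, Complex.norm_real]; exact hM _) s).const_mul
      (Complex.exp (Complex.I * σ * s))
    have h3 := (h2.sub (by fun_prop) (by fun_prop) h1).const_mul ((lam : ℂ) ^ n)
    convert h3 using 1
    · funext t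
      rw [twoSidedTerm, add_assoc, ← line_add, hd.eigen.backward_add_line hd.ne_zero,
        hd.eigen.backward_add_line hd.ne_zero]
      have e2 : Complex.exp (Complex.I * σ * s) *
          ((p (backward A n x + line w (b ^ (-n) * (t + s))) : ℂ) *
            Complex.exp (-(Complex.I * σ * ((t + s : ℝ) : ℂ)))) =
          (p (backward A n x + line w (b ^ (-n) * (t + s))) : ℂ) *
            Complex.exp (-(Complex.I * σ * t)) := by
        rw [mul_left_comm, ← Complex.exp_add]
        congr 2
        push_cast; ring
      rw [e2]
      push_cast
      ring
    · simp only [backward, line]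
      ring
  have hsum := hasMean_tsum hu
    (fun n => by have := continuous_twoSidedTerm (A := A) (lam := lam) (w := w) hpc s n; fun_prop)
    (fun n t => by
      rw [norm_mul, norm_exp_neg_I_mul, mul_one, Complex.norm_real]
      exact hu' s le_rfl _ n) hterm
  rw [tsum_mul_right] at hsum
  convert hsum using 2 with t
  · rw [tsum_mul_right, twoSided, Complex.ofReal_tsum]
  · rfl

theorem IsFractalDirection.twoSided_add_line_eq_zero (hd : IsFractalDirection A lam b w)
    (hp : IsBoundedLipschitz p) {x : UnitAddTorus (Fin k)} (h : ∀ s, twoSided A lam p w s x = 0)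
    (s t : ℝ) : twoSided A lam p w s (x + line w t) = 0 := by
  rw [← hd.twoSided_add hp, h, h, sub_zero]

/-- For `s = π / σ` the factor `e^{iσs} - 1` equals `-2`, so a vanishing series would force `g_σ =
0`. -/
theorem IsFractalDirection.exists_twoSided_ne_zero (hd : IsFractalDirection A lam b w)
    (hp : IsBoundedLipschitz p) {x : UnitAddTorus (Fin k)} (h : HasNonzeroCoeff A lam p x b w) :
    ∃ s, twoSided A lam p w s x ≠ 0 := by
  by_contra! hzero
  obtain ⟨σ, hσ, hne⟩ := h
  have h1 := hd.hasMean_twoSided hp x (Real.pi / σ) σ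
  simp only [hd.twoSided_add_line_eq_zero hp hzero, Complex.ofReal_zero, zero_mul] at h1
  have h2 := h1.unique (hasMean_const 0)
  have e : Complex.I * (σ : ℂ) * ((Real.pi / σ : ℝ) : ℂ) = Real.pi * Complex.I := by
    have : (σ : ℂ) ≠ 0 := by exact_mod_cast hσ
    push_cast
    field_simp
  rw [e, Complex.exp_pi_mul_I] at h2
  exact hne ((mul_eq_zero.1 h2).resolve_right (by norm_num))

/-- Without nonzero coefficients each increment is constant along the line, so the series at `n s`
is `n` times the series at `s`. This contradicts the Hölder bound of order `n^α`, `α < 1`, unless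
the value is zero. -/
theorem IsFractalDirection.twoSided_eq_zero (hd : IsFractalDirection A lam b w)
    (hp : IsBoundedLipschitz p) {x : UnitAddTorus (Fin k)} (h : ¬ HasNonzeroCoeff A lam p x b w)
    (s : ℝ) : twoSided A lam p w s x = 0 := by
  have h0 : ∀ σ : ℝ, σ ≠ 0 → gCoeff A lam p x b w σ = 0 := fun σ hσ => by
    by_contra hne
    exact h ⟨σ, hσ, hne⟩
  have hconst : ∀ t, twoSided A lam p w s (x + line w t) = twoSided A lam p w s x :=
    eq_const_of_hasMean_zero (hd.continuous_twoSided hp s) x w fun σ hσ => by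
      have := hd.hasMean_twoSided hp x s σ
      rwa [h0 σ hσ, zero_mul] at this
  have hmul : ∀ n : ℕ, twoSided A lam p w (n * s) x = n * twoSided A lam p w s x := by
    intro n
    induction n with
    | zero => simp [twoSided_zero]
    | succ n ih =>
      have := hd.twoSided_add hp s (n * s) x
      rw [hconst, ih] at this
      rw [show ((n + 1 : ℕ) : ℝ) * s = n * s + s by push_cast; ring]
      push_cast
      linarith
  obtain ⟨K, hK0, hK⟩ := hd.exists_twoSided_holder hp
  set α := holderExp lam b
  have hα : 0 < 1 - α := sub_pos.2 hd.holderExp_lt_one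
  have hle : ∀ᶠ n : ℕ in atTop, |twoSided A lam p w s x| ≤ K * |s| ^ α * ((n : ℝ) ^ (1 - α))⁻¹ := by
    filter_upwards [eventually_gt_atTop 0] with n hn
    have hn' : (0 : ℝ) < n := by exact_mod_cast hn
    have h1 := hK x (n * s)
    rw [hmul, abs_mul, abs_mul, abs_of_pos hn', Real.mul_rpow hn'.le (abs_nonneg s)] at h1
    have h2 : (n : ℝ) ^ (1 - α) * (n : ℝ) ^ α = n := by
      rw [← Real.rpow_add hn', sub_add_cancel, Real.rpow_one]
    have h3 : 0 < (n : ℝ) ^ α := by positivity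
    have h4 : 0 < (n : ℝ) ^ (1 - α) := by positivity
    rw [← div_eq_mul_inv, le_div_iff₀ h4]
    refine le_of_mul_le_mul_right (a := (n : ℝ) ^ α) ?_ h3
    calc _ = (n : ℝ) * |twoSided A lam p w s x| := by rw [mul_assoc, h2, mul_comm]
      _ ≤ _ := h1
      _ = _ := by ring
  have hlim : Tendsto (fun n : ℕ => K * |s| ^ α * ((n : ℝ) ^ (1 - α))⁻¹) atTop (𝓝 0) := by
    have := ((tendsto_rpow_atTop hα).comp tendsto_natCast_atTop_atTop).inv_tendsto_atTop.const_mul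
      (K * |s| ^ α)
    simpa using this
  exact abs_nonpos_iff.1 (ge_of_tendsto hlim hle)

/-- For a matrix with irreducible characteristic polynomial the coordinates of an eigenvector are
rationally independent. -/
theorem sum_mul_ne_zero_of_irreducible {A : GL (Fin k) ℤ}
    (hirr : Irreducible (A : Matrix (Fin k) (Fin k) ℤ).charpoly) {b : ℝ} {w : Fin k → ℝ}
    (hw : IsEigen A b w) (hw0 : w ≠ 0) {m : Fin k → ℤ} (hm : m ≠ 0) :
    ∑ i, (m i : ℝ) * w i ≠ 0 := by
  intro hzero
  set C : Matrix (Fin k) (Fin k) ℤ := (A : Matrix (Fin k) (Fin k) ℤ) with hC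
  have horth : ∀ n : ℕ, ∑ i, ((Matrix.vecMul m (C ^ n) i : ℤ) : ℝ) * w i = 0 := by
    intro n
    have h1 := hw.pow n
    unfold IsEigen at h1
    rw [Units.val_pow_eq_pow_val, ← hC] at h1
    have h2 : ∀ i, ((Matrix.vecMul m (C ^ n) i : ℤ) : ℝ) =
        Matrix.vecMul (fun j => (m j : ℝ)) ((C ^ n).map (Int.cast : ℤ → ℝ)) i := fun i => by
      simp [Matrix.vecMul, dotProduct]
    simp only [h2]
    change Matrix.vecMul (fun j => (m j : ℝ)) ((C ^ n).map (Int.cast : ℤ → ℝ)) ⬝ᵥ w = 0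
    rw [← Matrix.dotProduct_mulVec, h1, dotProduct_smul]
    change b ^ n • ∑ i, (m i : ℝ) * w i = 0
    rw [hzero, smul_zero]
  -- The `k` row vectors `m C^j` are all orthogonal to `w ≠ 0`, hence linearly dependent. A
  -- dependence is a nonzero polynomial `f` of degree less than `k` with `m f(C) = 0`.
  set Q : Matrix (Fin k) (Fin k) ℤ := fun j => Matrix.vecMul m (C ^ (j : ℕ)) with hQ
  have hdet : Q.det = 0 := by
    have h1 : (Q.map (Int.cast : ℤ → ℝ)).det = 0 := by
      refine Matrix.exists_mulVec_eq_zero_iff.1 ⟨w, hw0, ?_⟩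
      funext j
      exact horth j
    have h2 := Int.cast_det (R := ℝ) Q
    rw [h1] at h2
    exact_mod_cast h2
  obtain ⟨c, hc0, hc⟩ := Matrix.exists_vecMul_eq_zero_iff.2 hdet
  set f : Polynomial ℤ := ∑ j : Fin k, Polynomial.monomial (j : ℕ) (c j) with hf
  have hcoeff : ∀ j : Fin k, f.coeff j = c j := fun j => by
    simp [hf, Polynomial.finsetSum_coeff, Polynomial.coeff_monomial, Fin.val_inj]
  have hf0 : f ≠ 0 := by
    obtain ⟨j, hj⟩ := Function.ne_iff.1 hc0
    intro h
    apply hj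
    rw [← hcoeff, h]; simp
  have hdeg : f.degree < (C.charpoly).degree := by
    rw [Matrix.charpoly_degree_eq_dim, Fintype.card_fin]
    refine lt_of_le_of_lt (Polynomial.degree_sum_le _ _) ?_
    refine (Finset.sup_lt_iff (WithBot.bot_lt_coe k)).2 fun j _ => ?_
    exact (Polynomial.degree_monomial_le _ _).trans_lt (Nat.cast_lt.2 j.2)
  have hann : Matrix.vecMul m (Polynomial.aeval C f) = 0 := by
    have : Polynomial.aeval C f = ∑ j : Fin k, c j • C ^ (j : ℕ) := by
      simp [hf, Polynomial.aeval_monomial]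
    rw [this, ← hc]
    funext i
    simp only [Matrix.vecMul, dotProduct, hQ, Matrix.sum_apply, Matrix.smul_apply, Finset.mul_sum,
      smul_eq_mul]
    rw [Finset.sum_comm]
    refine Finset.sum_congr rfl fun j _ => Finset.sum_congr rfl fun a _ => ?_
    ring
  have hmonic := Matrix.charpoly_monic C
  have hirrQ := (hmonic.irreducible_iff_irreducible_map_fraction_map (K := ℚ)).1 hirr
  set φ : ℤ →+* ℚ := algebraMap ℤ ℚ with hφ
  have hinj : Function.Injective φ := Int.cast_injective
  -- Irreducibility over `ℚ` (Gauss's lemma) and the degree bound make `f` coprime to the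
  -- characteristic polynomial, so `f(C)` is invertible by Cayley-Hamilton and `m = 0`.
  have hcop : IsCoprime (C.charpoly.map φ) (f.map φ) := by
    refine (hirrQ.coprime_iff_not_dvd).2 fun hdvd => ?_
    have := Polynomial.degree_le_of_dvd hdvd ((Polynomial.map_ne_zero_iff hinj).2 hf0)
    rw [Polynomial.degree_map_eq_of_injective hinj, Polynomial.degree_map_eq_of_injective hinj] at this
    exact absurd hdeg (not_lt.2 this)
  obtain ⟨u, v, huv⟩ := hcop
  have h1 := congrArg (Polynomial.aeval (C.map φ)) huv
  have h2 : Polynomial.aeval (C.map φ) (C.charpoly.map φ) = 0 := by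
    rw [← Matrix.charpoly_map]; exact Matrix.aeval_self_charpoly _
  have h3 : Polynomial.aeval (C.map φ) (f.map φ) = (Polynomial.aeval C f).map φ := by
    rw [Polynomial.aeval_map_algebraMap]
    exact Polynomial.aeval_algHom_apply ((Algebra.ofId ℤ ℚ).mapMatrix (m := Fin k)) C f
  rw [mul_comm v, map_add, map_mul, map_mul, h2, mul_zero, zero_add, map_one, h3] at h1
  have h4 : Matrix.vecMul (φ ∘ m) ((Polynomial.aeval C f).map φ) = 0 := by
    funext i
    rw [← RingHom.map_vecMul, hann]
    simp
  have h5 := congrArg (Matrix.vecMul (φ ∘ m)) h1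
  rw [← Matrix.vecMul_vecMul, h4, Matrix.zero_vecMul, Matrix.vecMul_one] at h5
  exact hm (funext fun i => hinj (by simpa using (congrFun h5 i).symm))

end SkewSlice

/-! ### Box counting for graphs of Hölder functions. -/

namespace SkewSlice

section Counting

variable {M : Type*} [PseudoEMetricSpace M]

theorem boxCoverNumber_le_card {ι : Type*} [Fintype ι] {δ : ℝ} {X : Set M} (U : ι → Set M)
    (hU : ∀ m, Metric.ediam (U m) ≤ ENNReal.ofReal δ) (hX : X ⊆ ⋃ m, U m) :
    boxCoverNumber δ X ≤ Fintype.card ι := by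
  refine Nat.sInf_le ⟨fun m => U ((Fintype.equivFin ι).symm m), fun m => hU _, fun x hx => ?_⟩
  obtain ⟨m, hm⟩ := Set.mem_iUnion.1 (hX hx)
  exact Set.mem_iUnion.2 ⟨Fintype.equivFin ι m, by simpa using hm⟩

theorem exists_cover_boxCoverNumber {ι : Type*} [Fintype ι] {δ : ℝ} {X : Set M} (U : ι → Set M)
    (hU : ∀ m, Metric.ediam (U m) ≤ ENNReal.ofReal δ) (hX : X ⊆ ⋃ m, U m) :
    ∃ V : Fin (boxCoverNumber δ X) → Set M,
      (∀ m, Metric.ediam (V m) ≤ ENNReal.ofReal δ) ∧ X ⊆ ⋃ m, V m := by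
  refine Nat.sInf_mem (s := {n : ℕ | ∃ U : Fin n → Set M,
    (∀ m, Metric.ediam (U m) ≤ ENNReal.ofReal δ) ∧ X ⊆ ⋃ m, U m})
    ⟨Fintype.card ι, fun m => U ((Fintype.equivFin ι).symm m), fun m => hU _, fun x hx => ?_⟩
  obtain ⟨m, hm⟩ := Set.mem_iUnion.1 (hX hx)
  exact Set.mem_iUnion.2 ⟨Fintype.equivFin ι m, by simpa using hm⟩

theorem hasBoxDim_of_bounds {X : Set M} (hne : X.Nonempty) (htb : TotallyBounded X)
    {d c C δ₀ : ℝ} (hc : 0 < c) (hC : 0 < C) (hδ₀ : 0 < δ₀)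
    (h : ∀ δ, 0 < δ → δ < δ₀ → c * δ ^ (-d) ≤ boxCoverNumber δ X ∧
      (boxCoverNumber δ X : ℝ) ≤ C * δ ^ (-d)) : HasBoxDim X d := by
  refine ⟨hne, htb, ?_⟩
  have hlog : Tendsto (fun δ : ℝ => -Real.log δ) (𝓝[>] 0) atTop :=
    tendsto_neg_atBot_atTop.comp Real.tendsto_log_nhdsGT_zero
  have hlim : ∀ a : ℝ, Tendsto (fun δ : ℝ => Real.log a / (-Real.log δ) + d) (𝓝[>] 0) (𝓝 d) :=
    fun a => by
      simpa using (hlog.const_div_atTop (Real.log a)).add_const d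
  have hev : ∀ᶠ δ : ℝ in 𝓝[>] 0, 0 < δ ∧ δ < δ₀ ∧ δ < 1 := by
    filter_upwards [self_mem_nhdsWithin, nhdsWithin_le_nhds (Iio_mem_nhds hδ₀),
      nhdsWithin_le_nhds (Iio_mem_nhds one_pos)] with δ h1 h2 h3 using ⟨h1, h2, h3⟩
  have hexp : ∀ a δ : ℝ, 0 < a → 0 < δ → δ < 1 →
      Real.log a / (-Real.log δ) + d = Real.log (a * δ ^ (-d)) / (-Real.log δ) := by
    intro a δ ha h0 h1
    have := (Real.log_neg h0 h1).ne
    rw [Real.log_mul ha.ne' (Real.rpow_pos_of_pos h0 _).ne', Real.log_rpow h0]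
    field_simp
    ring
  refine tendsto_of_tendsto_of_tendsto_of_le_of_le' (hlim c) (hlim C) ?_ ?_
  · filter_upwards [hev] with δ ⟨h0, h1, h2⟩
    have := Real.log_neg h0 h2
    rw [hexp c δ hc h0 h2]
    refine div_le_div_of_nonneg_right (Real.log_le_log (by positivity) (h δ h0 h1).1) (by linarith)
  · filter_upwards [hev] with δ ⟨h0, h1, h2⟩
    have := Real.log_neg h0 h2
    rw [hexp C δ hC h0 h2]
    have hpos : 0 < (boxCoverNumber δ X : ℝ) := lt_of_lt_of_le (by positivity) (h δ h0 h1).1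
    refine div_le_div_of_nonneg_right (Real.log_le_log hpos (h δ h0 h1).2) (by linarith)

end Counting

section Graph

variable {D : Type*} [PseudoMetricSpace D]

/-- `S` is covered by at most `K δ^{-s}` sets of diameter at most `δ`, for each `δ < 1`. -/
def HasCovers (S : Set D) (s : ℕ) (K : ℝ) : Prop :=
  ∀ δ : ℝ, 0 < δ → δ < 1 → ∃ (ι : Type) (_ : Fintype ι) (V : ι → Set D),
    (Fintype.card ι : ℝ) ≤ K * δ ^ (-(s : ℝ)) ∧ S ⊆ ⋃ i, V i ∧
      ∀ i, ∀ y ∈ V i, ∀ z ∈ V i, dist y z ≤ δ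

/-- Over each `V i` the values of `f` lie in an interval of length `2ω`, which is cut into pieces of
length `δ`. -/
theorem exists_graph_cover {S : Set D} {f : D → ℝ} {ι : Type} [Fintype ι] {V : ι → Set D}
    (hV : S ⊆ ⋃ i, V i) {δ ω : ℝ} (hδ : 0 < δ)
    (hdiam : ∀ i, ∀ y ∈ V i, ∀ z ∈ V i, dist y z ≤ δ)
    (hosc : ∀ y ∈ S, ∀ z ∈ S, dist y z ≤ δ → |f y - f z| ≤ ω) :
    ∃ U : ι × Fin (⌊2 * ω / δ⌋₊ + 1) → Set (D × ℝ),
      (∀ m, Metric.ediam (U m) ≤ ENNReal.ofReal δ) ∧ (fun y => (y, f y)) '' S ⊆ ⋃ m, U m := by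
  have h1 : ∀ i, ∃ a : ℝ, ∀ y ∈ V i ∩ S, a ≤ f y ∧ f y ≤ a + 2 * ω := by
    intro i
    rcases (V i ∩ S).eq_empty_or_nonempty with h | ⟨z, hz⟩
    · exact ⟨0, fun y hy => by simp [h] at hy⟩
    · refine ⟨f z - ω, fun y hy => ?_⟩
      have := abs_le.1 (hosc y hy.2 z hz.2 (hdiam i y hy.1 z hz.1))
      constructor <;> linarith
  choose a ha using h1
  refine ⟨fun m => {q | q.1 ∈ V m.1 ∧ a m.1 + m.2 * δ ≤ q.2 ∧ q.2 ≤ a m.1 + (m.2 + 1) * δ}, ?_, ?_⟩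
  · intro m
    refine Metric.ediam_le fun q hq q' hq' => ?_
    rw [edist_dist]
    refine ENNReal.ofReal_le_ofReal ?_
    rw [Prod.dist_eq]
    refine max_le (hdiam _ _ hq.1 _ hq'.1) ?_
    rw [Real.dist_eq, abs_le]
    constructor <;> linarith [hq.2.1, hq.2.2, hq'.2.1, hq'.2.2]
  · rintro _ ⟨y, hy, rfl⟩
    obtain ⟨i, hi⟩ := Set.mem_iUnion.1 (hV hy)
    obtain ⟨h1, h2⟩ := ha i y ⟨hi, hy⟩
    have h3 : 0 ≤ (f y - a i) / δ := div_nonneg (by linarith) hδ.le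
    have h4 : ⌊(f y - a i) / δ⌋₊ < ⌊2 * ω / δ⌋₊ + 1 :=
      Nat.lt_succ_of_le (Nat.floor_le_floor (by gcongr; linarith))
    have h5 := Nat.floor_le h3
    have h6 := Nat.lt_floor_add_one ((f y - a i) / δ)
    rw [le_div_iff₀ hδ] at h5
    rw [div_lt_iff₀ hδ] at h6
    refine Set.mem_iUnion.2 ⟨(i, ⟨_, h4⟩), hi, ?_, ?_⟩
    · simp only; linarith
    · simp only; linarith

/-- The lower bound on covers comes from an area. The region between `f` and `g` lies in the
`δ`-neighbourhood of the graph of `f`, and the `δ`-neighbourhood of a covering set lies in a product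
of balls of radius `2δ`, of measure at most `κ (2δ)^s · 4δ`. -/
theorem integral_le_boxCount [MeasurableSpace D] [OpensMeasurableSpace D] {μ : Measure D}
    [SigmaFinite μ]
    {s N : ℕ} {κ : ℝ} (hκ : 0 ≤ κ)
    (hball : ∀ y ρ, 0 ≤ ρ → μ (Metric.closedBall y ρ) ≤ ENNReal.ofReal (κ * ρ ^ s))
    {S S' : Set D} (hS' : MeasurableSet S') {f g : D → ℝ} (hf : IntegrableOn f S' μ)
    (hg : IntegrableOn g S' μ) {δ : ℝ} (hδ : 0 < δ)
    (hreg : ∀ y ∈ S', ∀ z ∈ Set.uIcc (f y) (g y), ∃ y' ∈ S, dist y y' ≤ δ ∧ |z - f y'| ≤ δ)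
    {U : Fin N → Set (D × ℝ)} (hU : ∀ m, Metric.ediam (U m) ≤ ENNReal.ofReal δ)
    (hcov : (fun y => (y, f y)) '' S ⊆ ⋃ m, U m) :
    ∫ y in S', |g y - f y| ∂μ ≤ N * (κ * (2 * δ) ^ s * (4 * δ)) := by
  have hvol := volume_regionBetween_eq_integral (μ := μ) (f := fun y => min (f y) (g y))
    (g := fun y => max (f y) (g y)) (hf.inf hg) (hf.sup hg) hS' (fun y _ => min_le_max)
  have hsub : regionBetween (fun y => min (f y) (g y)) (fun y => max (f y) (g y)) S' ⊆
      ⋃ m, {q | ∃ q' ∈ U m, dist q q' ≤ δ} := by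
    rintro ⟨y, z⟩ ⟨hy, hz⟩
    obtain ⟨y', hy', h1, h2⟩ := hreg y hy z ⟨hz.1.le, hz.2.le⟩
    obtain ⟨m, hm⟩ := Set.mem_iUnion.1 (hcov ⟨y', hy', rfl⟩)
    refine Set.mem_iUnion.2 ⟨m, _, hm, ?_⟩
    rw [Prod.dist_eq]
    exact max_le h1 h2
  have hthick : ∀ m, (μ.prod volume) {q | ∃ q' ∈ U m, dist q q' ≤ δ} ≤
      ENNReal.ofReal (κ * (2 * δ) ^ s * (4 * δ)) := by
    intro m
    rcases (U m).eq_empty_or_nonempty with h | ⟨q₀, hq₀⟩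
    · simp [h]
    · have hs : {q | ∃ q' ∈ U m, dist q q' ≤ δ} ⊆
          Metric.closedBall q₀.1 (2 * δ) ×ˢ Metric.closedBall q₀.2 (2 * δ) := by
        rw [closedBall_prod_same]
        rintro q ⟨q', hq', hd⟩
        have h1 := (Metric.edist_le_ediam_of_mem hq' hq₀).trans (hU m)
        rw [edist_dist, ENNReal.ofReal_le_ofReal_iff hδ.le] at h1
        exact (dist_triangle q q' _).trans (by linarith)
      refine (measure_mono hs).trans ?_
      rw [Measure.prod_prod, Real.volume_closedBall, ENNReal.ofReal_mul (p := κ * (2 * δ) ^ s) (by positivity)]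
      refine mul_le_mul' (hball _ _ (by positivity)) (le_of_eq ?_)
      congr 1; ring
  have e : ∀ y, max (f y) (g y) - min (f y) (g y) = |g y - f y| := fun y => by
    rw [max_sub_min_eq_abs, abs_sub_comm]
  simp only [Pi.sub_apply, e] at hvol
  have hle := (measure_mono hsub).trans (measure_iUnion_fintype_le (μ.prod volume)
    fun m : Fin N => {q | ∃ q' ∈ U m, dist q q' ≤ δ})
  rw [hvol] at hle
  have hle2 := hle.trans (Finset.sum_le_sum fun m _ => hthick m)
  rw [Finset.sum_const, Finset.card_univ, Fintype.card_fin, nsmul_eq_mul,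
    ← ENNReal.ofReal_natCast, ← ENNReal.ofReal_mul (by positivity)] at hle2
  exact (ENNReal.ofReal_le_ofReal_iff (by positivity)).1 hle2

/-- The box dimension of the graph of a Hölder function which oscillates as much as its Hölder
exponent permits. -/
theorem hasBoxDim_graph [MeasurableSpace D] [OpensMeasurableSpace D] {μ : Measure D}
    [SigmaFinite μ] [IsFiniteMeasureOnCompacts μ] {s : ℕ} {κ K C α c δ₀ : ℝ} (hκ : 0 < κ)
    (hball : ∀ y ρ, 0 ≤ ρ → μ (Metric.closedBall y ρ) ≤ ENNReal.ofReal (κ * ρ ^ s))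
    {S : Set D} (hS : IsCompact S) (hne : S.Nonempty) (hcov : HasCovers S s K)
    {f : D → ℝ} (hf : Continuous f) (hα1 : α ≤ 1) (hC : 0 ≤ C)
    (hhol : ∀ y ∈ S, ∀ z ∈ S, ∀ δ > 0, dist y z ≤ δ → |f y - f z| ≤ C * δ ^ α)
    (hc : 0 < c) (hδ₀ : 0 < δ₀)
    (hlow : ∀ δ, 0 < δ → δ < δ₀ → ∃ (g : D → ℝ) (S' : Set D), Continuous g ∧ IsCompact S' ∧
      MeasurableSet S' ∧
      (∀ y ∈ S', ∀ z ∈ Set.uIcc (f y) (g y), ∃ y' ∈ S, dist y y' ≤ δ ∧ |z - f y'| ≤ δ) ∧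
      c * δ ^ α ≤ ∫ y in S', |g y - f y| ∂μ) :
    HasBoxDim ((fun y => (y, f y)) '' S) (s + 1 - α) := by
  have hcomp : IsCompact ((fun y => (y, f y)) '' S) := hS.image (by fun_prop)
  have hK : 0 < |K| + 1 := by positivity
  refine hasBoxDim_of_bounds (hne.image _) hcomp.totallyBounded (c := c / (κ * 2 ^ s * 4))
    (C := (|K| + 1) * (2 * C + 1)) (δ₀ := min δ₀ 1) (by positivity) (by positivity)
    (lt_min hδ₀ one_pos) fun δ h0 h1 => ?_
  obtain ⟨ι, _, V, hcard, hV, hdiam⟩ := hcov δ h0 (h1.trans_le (min_le_right _ _))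
  have h1' : δ ≤ 1 := (h1.trans_le (min_le_right _ _)).le
  have hδα : 0 < δ ^ α := by positivity
  obtain ⟨U, hU, hUc⟩ := exists_graph_cover hV (ω := C * δ ^ α) h0 hdiam
    (fun y hy z hz hd => hhol y hy z hz δ h0 hd)
  have e : δ ^ (-((s : ℝ) + 1 - α)) = δ ^ (-(s : ℝ)) * (δ ^ α / δ) := by
    rw [← Real.rpow_sub_one h0.ne', ← Real.rpow_add h0]
    congr 1; ring
  constructor
  · obtain ⟨W, hW, hWc⟩ := exists_cover_boxCoverNumber U hU hUc
    obtain ⟨g, S', hg, hS'c, hS'm, hreg, hint⟩ := hlow δ h0 (h1.trans_le (min_le_left _ _))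
    have := hint.trans (integral_le_boxCount hκ.le hball hS'm (hf.continuousOn.integrableOn_compact' hS'c hS'm)
      (hg.continuousOn.integrableOn_compact' hS'c hS'm) h0 hreg hW hWc)
    rw [e, Real.rpow_neg h0.le, Real.rpow_natCast]
    calc c / (κ * 2 ^ s * 4) * ((δ ^ s)⁻¹ * (δ ^ α / δ))
        = (c * δ ^ α) / (κ * (2 * δ) ^ s * (4 * δ)) := by
          rw [mul_pow]; field_simp
      _ ≤ _ := by
          rw [div_le_iff₀ (by positivity)]; exact this
  · refine (Nat.cast_le.2 (boxCoverNumber_le_card U hU hUc)).trans ?_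
    rw [Fintype.card_prod, Fintype.card_fin, e]
    push_cast
    have h2 : (Fintype.card ι : ℝ) ≤ (|K| + 1) * δ ^ (-(s : ℝ)) :=
      hcard.trans (by gcongr; linarith [le_abs_self K])
    have h3 : (⌊2 * (C * δ ^ α) / δ⌋₊ : ℝ) ≤ 2 * (C * δ ^ α) / δ := Nat.floor_le (by positivity)
    -- Here `α ≤ 1` is needed: it absorbs the extra box per column coming from the floor.
    have h4 : 1 ≤ δ ^ α / δ := by
      rw [← Real.rpow_sub_one h0.ne']
      exact Real.one_le_rpow_of_pos_of_le_one_of_nonpos h0 h1' (by linarith)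
    calc _ ≤ ((|K| + 1) * δ ^ (-(s : ℝ))) * (2 * (C * δ ^ α) / δ + δ ^ α / δ) := by gcongr
      _ = _ := by ring

end Graph

/-- The lower bounds hold only along a geometric sequence of scales; any small `δ` is comparable to
one of them. -/
theorem exists_scale {q α a : ℝ} (hq0 : 0 < q) (hq1 : q < 1) (hα : 0 < α) (ha : 0 < a) (N₀ : ℕ) :
    ∃ c δ₀ : ℝ, 0 < c ∧ 0 < δ₀ ∧ ∀ δ, 0 < δ → δ < δ₀ →
      ∃ N, N₀ ≤ N ∧ q ^ N * a ≤ δ ∧ c * δ ^ α ≤ (q ^ N) ^ α := by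
  refine ⟨(q / a) ^ α, q ^ N₀ * a, by positivity, by positivity, fun δ h0 h1 => ?_⟩
  have h2 : δ / a < q ^ N₀ := (div_lt_iff₀ ha).2 h1
  obtain ⟨n, hn1, hn2⟩ := exists_nat_pow_near_of_lt_one (x := δ / a) (by positivity)
    (h2.le.trans (pow_le_one₀ hq0.le hq1.le)) hq0 hq1
  refine ⟨n + 1, ?_, ?_, ?_⟩
  · exact ((pow_lt_pow_iff_right_of_lt_one₀ hq0 hq1).1 (hn1.trans h2)).le
  · exact ((lt_div_iff₀ ha).1 hn1).le
  · rw [← Real.mul_rpow (by positivity) h0.le]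
    refine Real.rpow_le_rpow (by positivity) ?_ hα.le
    calc q / a * δ = δ / a * q := by ring
      _ ≤ q ^ n * q := by gcongr
      _ = _ := (pow_succ _ _).symm

theorem hasCovers_Icc {r : ℝ} (hr : 0 < r) : HasCovers (Set.Icc (-r) r) 1 (2 * r + 1) := by
  intro δ h0 h1
  refine ⟨Fin (⌊2 * r / δ⌋₊ + 1), inferInstance,
    fun j => Set.Icc (-r + j * δ) (-r + (j + 1) * δ), ?_, ?_, ?_⟩
  · rw [Fintype.card_fin, Nat.cast_one, Real.rpow_neg_one]
    push_cast
    have h2 : (⌊2 * r / δ⌋₊ : ℝ) ≤ 2 * r / δ := Nat.floor_le (by positivity)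
    have h3 : 1 ≤ δ⁻¹ := (one_le_inv₀ h0).2 h1.le
    rw [add_mul, one_mul, ← div_eq_mul_inv]
    linarith
  · intro t ht
    have h3 : 0 ≤ (t + r) / δ := div_nonneg (by linarith [ht.1]) h0.le
    have h4 : ⌊(t + r) / δ⌋₊ < ⌊2 * r / δ⌋₊ + 1 :=
      Nat.lt_succ_of_le (Nat.floor_le_floor (by gcongr; linarith [ht.2]))
    have h5 := Nat.floor_le h3
    have h6 := Nat.lt_floor_add_one ((t + r) / δ)
    rw [le_div_iff₀ h0] at h5
    rw [div_lt_iff₀ h0] at h6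
    refine Set.mem_iUnion.2 ⟨⟨_, h4⟩, ?_, ?_⟩
    · simp only; linarith
    · simp only; linarith
  · intro j y hy z hz
    rw [Real.dist_eq, abs_le]
    constructor <;> linarith [hy.1, hy.2, hz.1, hz.2]

theorem hasCovers_torus (k : ℕ) : HasCovers (Set.univ : Set (UnitAddTorus (Fin k))) k (2 ^ k) := by
  intro δ h0 h1
  set n := ⌈1 / δ⌉₊ with hn
  have hn1 : 1 / δ ≤ n := Nat.le_ceil _
  have hn0 : (0 : ℝ) < n := lt_of_lt_of_le (by positivity) hn1
  have hn2 : (n : ℝ) ≤ 2 / δ := by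
    have h2 := Nat.ceil_lt_add_one (a := 1 / δ) (by positivity)
    have h3 : 1 ≤ 1 / δ := by rw [le_div_iff₀ h0]; linarith
    have h4 : 2 / δ = 1 / δ + 1 / δ := by ring
    linarith
  refine ⟨Fin k → Fin n, inferInstance,
    fun j => torusProj '' {u | ∀ m, (j m : ℝ) / n ≤ u m ∧ u m ≤ ((j m : ℝ) + 1) / n}, ?_, ?_, ?_⟩
  · rw [Fintype.card_fun, Fintype.card_fin, Fintype.card_fin, Real.rpow_neg h0.le,
      Real.rpow_natCast]
    push_cast
    calc (n : ℝ) ^ k ≤ (2 / δ) ^ k := by gcongr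
      _ = _ := by rw [div_pow]; ring
  · intro y _
    have h : ∀ m, ∃ t : ℝ, (t : UnitAddCircle) = y m ∧ 0 ≤ t ∧ t < 1 := by
      intro m
      refine ⟨AddCircle.equivIco 1 0 (y m), (AddCircle.equivIco 1 0).symm_apply_apply (y m), ?_, ?_⟩
      · exact (AddCircle.equivIco 1 0 (y m)).2.1
      · simpa using (AddCircle.equivIco 1 0 (y m)).2.2
    choose u hu hu0 hu1 using h
    have hfl : ∀ m, ⌊u m * n⌋₊ < n := fun m => by
      rw [Nat.floor_lt (mul_nonneg (hu0 m) hn0.le)]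
      exact mul_lt_of_lt_one_left hn0 (hu1 m)
    refine Set.mem_iUnion.2 ⟨fun m => ⟨_, hfl m⟩, u, fun m => ⟨?_, ?_⟩, funext hu⟩
    · rw [div_le_iff₀ hn0]
      exact Nat.floor_le (mul_nonneg (hu0 m) hn0.le)
    · rw [le_div_iff₀ hn0]
      exact (Nat.lt_floor_add_one _).le
  · rintro j _ ⟨u, hu, rfl⟩ _ ⟨u', hu', rfl⟩
    have e : torusProj u - torusProj u' = torusProj (u - u') := rfl
    rw [dist_eq_norm, e]
    refine (norm_torusProj_le _).trans ((pi_norm_le_iff_of_nonneg h0.le).2 fun m => ?_)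
    have h2 : ((j m : ℝ) + 1) / n - (j m : ℝ) / n ≤ δ := by
      rw [← sub_div, add_sub_cancel_left, div_le_iff₀ hn0]
      rw [div_le_iff₀ h0] at hn1
      linarith
    rw [Pi.sub_apply, Real.norm_eq_abs, abs_le]
    constructor <;> linarith [hu m, hu' m]

theorem volume_closedBall_torus_le {k : ℕ} (y : UnitAddTorus (Fin k)) (ρ : ℝ) (hρ : 0 ≤ ρ) :
    volume (Metric.closedBall y ρ) ≤ ENNReal.ofReal (2 ^ k * ρ ^ k) := by
  rw [volume_pi_closedBall y hρ, ← mul_pow, ENNReal.ofReal_pow (by positivity)]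
  refine (Finset.prod_le_prod' (g := fun _ => ENNReal.ofReal (2 * ρ)) fun m _ => ?_).trans ?_
  · rw [AddCircle.volume_closedBall]
    exact ENNReal.ofReal_le_ofReal (min_le_right _ _)
  · simp

theorem volume_closedBall_real_le (y ρ : ℝ) (_ : 0 ≤ ρ) :
    volume (Metric.closedBall y ρ) ≤ ENNReal.ofReal (2 * ρ ^ 1) := by
  rw [Real.volume_closedBall, pow_one]

end SkewSlice

/-! ### Dimensions of the slices and of the whole graph. -/

namespace SkewSlice

variable {k : ℕ} {A : GL (Fin k) ℤ} {lam b : ℝ} {w : Fin k → ℝ} {p : UnitAddTorus (Fin k) → ℝ}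

/-- `f` is uniformly Hölder with exponent `α` along the lines of direction `w`. -/
def HasDirHolder (f : UnitAddTorus (Fin k) → ℝ) (w : Fin k → ℝ) (α : ℝ) : Prop :=
  ∃ C, 0 ≤ C ∧ ∀ y s, |f (y + line w s) - f y| ≤ C * |s| ^ α

theorem HasDirHolder.mono {f : UnitAddTorus (Fin k) → ℝ} (hf : Continuous f) {α β : ℝ}
    (h : HasDirHolder f w β) (hα : 0 < α) (hαβ : α ≤ β) : HasDirHolder f w α := by
  obtain ⟨C, hC0, hC⟩ := h
  obtain ⟨M, hM0, hM⟩ := exists_bound hf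
  refine ⟨C + 2 * M, by positivity, fun y s => ?_⟩
  have hs := abs_nonneg s
  rcases le_total |s| 1 with h1 | h1
  · calc _ ≤ C * |s| ^ β := hC y s
      _ ≤ C * |s| ^ α := mul_le_mul_of_nonneg_left
          (Real.rpow_le_rpow_of_exponent_ge' hs h1 hα.le hαβ) hC0
      _ ≤ _ := mul_le_mul_of_nonneg_right (by linarith) (by positivity)
  · calc _ ≤ 2 * M := (abs_sub _ _).trans (by linarith [hM (y + line w s), hM y])
      _ ≤ (C + 2 * M) * 1 := by linarith
      _ ≤ _ := mul_le_mul_of_nonneg_left (Real.one_le_rpow h1 hα.le) (by positivity)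

theorem IsFractalDirection.hasDirHolder (hd : IsFractalDirection A lam b w)
    (hp : IsBoundedLipschitz p) : HasDirHolder (skewPhi A lam p) w (holderExp lam b) := by
  have hcont := continuous_skewPhi (A := A) hp hd.lam_pos hd.lam_lt_one
  obtain ⟨K, hK0, hK⟩ := hd.exists_twoSided_holder hp
  obtain ⟨C, hC0, hC⟩ := hd.skewPhi_sub_le hp
  obtain ⟨M, hM0, hM⟩ := exists_bound hcont
  have hα := hd.holderExp_pos
  refine ⟨K + C + 2 * M, by positivity, fun y s => ?_⟩
  have hs := abs_nonneg s
  rcases le_total |s| 1 with h1 | h1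
  · have h2 : |s| ≤ |s| ^ holderExp lam b := by
      simpa using Real.rpow_le_rpow_of_exponent_ge' hs h1 hα.le hd.holderExp_lt_one.le
    have h3 := abs_sub_abs_le_abs_sub (skewPhi A lam p (y + line w s) - skewPhi A lam p y)
      (twoSided A lam p w s y)
    have h4 : C * |s| ≤ C * |s| ^ holderExp lam b := by gcongr
    have h5 : 0 ≤ 2 * M * |s| ^ holderExp lam b := by positivity
    linarith [hK y s, hC y s]
  · calc _ ≤ 2 * M := (abs_sub _ _).trans (by linarith [hM (y + line w s), hM y])
      _ ≤ (K + C + 2 * M) * 1 := by linarith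
      _ ≤ _ := mul_le_mul_of_nonneg_left (Real.one_le_rpow h1 hα.le) (by positivity)

theorem IsFractalDirection.skewPhi_lipschitz_line (hd : IsFractalDirection A lam b w)
    (hp : IsBoundedLipschitz p) : ∃ C, 0 ≤ C ∧ ∀ y, (∀ s, twoSided A lam p w s y = 0) →
      ∀ s, |skewPhi A lam p (y + line w s) - skewPhi A lam p y| ≤ C * |s| := by
  obtain ⟨C, hC0, hC⟩ := hd.skewPhi_sub_le hp
  exact ⟨C, hC0, fun y hy s => by simpa [hy s] using hC y s⟩

theorem subSliceGraph_eq (x : UnitAddTorus (Fin k)) (w : Fin k → ℝ) (r : ℝ) :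
    subSliceGraph A lam p x w r =
      (fun t => (t, (fun t => skewPhi A lam p (x + line w t)) t)) '' Set.Icc (-r) r := rfl

theorem add_line_eq (x : UnitAddTorus (Fin k)) (w : Fin k → ℝ) (s t : ℝ) :
    x + line w s = x + line w t + line w (s - t) := by
  rw [add_assoc, ← line_add]; congr 2; ring

theorem hasBoxDim_slice_of_lipschitz {x : UnitAddTorus (Fin k)} {C : ℝ} (hC0 : 0 ≤ C)
    (hcont : Continuous (skewPhi A lam p))
    (hC : ∀ t s, |skewPhi A lam p (x + line w t + line w s) - skewPhi A lam p (x + line w t)| ≤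
      C * |s|) {r : ℝ} (hr : 0 < r) : HasBoxDim (subSliceGraph A lam p x w r) 1 := by
  have hline := continuous_line w
  have hr' : -r ≤ r := by linarith
  rw [subSliceGraph_eq]
  have := hasBoxDim_graph (μ := volume) (s := 1) (κ := 2) (C := C) (α := 1) (c := 2 * r) (δ₀ := 1)
    two_pos volume_closedBall_real_le isCompact_Icc (Set.nonempty_Icc.2 hr') (hasCovers_Icc hr)
    (f := fun t => skewPhi A lam p (x + line w t)) (by fun_prop) le_rfl hC0 ?_ (by positivity)
    one_pos ?_
  · simpa using this
  · intro y _ z _ δ _ hd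
    rw [add_line_eq x w y z, Real.rpow_one]
    refine (hC _ _).trans (mul_le_mul_of_nonneg_left ?_ hC0)
    rwa [← Real.dist_eq]
  · intro δ h0 _
    -- A vertical shift by `δ` already encloses the area `2rδ` required for exponent `1`.
    refine ⟨fun t => skewPhi A lam p (x + line w t) + δ, Set.Icc (-r) r, by fun_prop, isCompact_Icc,
      measurableSet_Icc, fun y hy z hz => ⟨y, hy, by simpa using h0.le, ?_⟩, ?_⟩
    · rw [Set.uIcc_of_le (by linarith)] at hz
      rw [abs_le]
      constructor <;> linarith [hz.1, hz.2]
    · simp only [add_sub_cancel_left, abs_of_pos h0, setIntegral_const, smul_eq_mul, Real.rpow_one]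
      rw [Real.volume_real_Icc_of_le hr']
      exact le_of_eq (by ring)

/-- By the intermediate value theorem, the region between `f` and a translate of it by a short step
stays close to the graph of `f`. -/
theorem exists_mem_uIcc_line {f : UnitAddTorus (Fin k) → ℝ} (hf : Continuous f)
    (y : UnitAddTorus (Fin k)) (w : Fin k → ℝ) (τ : ℝ) {z : ℝ}
    (hz : z ∈ Set.uIcc (f y) (f (y + line w τ))) : ∃ t, |t| ≤ |τ| ∧ f (y + line w t) = z := by
  have hline := continuous_line w
  have h := intermediate_value_uIcc (a := 0) (b := τ) (f := fun t => f (y + line w t))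
    (Continuous.continuousOn (by fun_prop))
  simp only [line_zero, add_zero] at h
  obtain ⟨t, ht, htz⟩ := h hz
  refine ⟨t, ?_, htz⟩
  have := Set.abs_sub_left_of_mem_uIcc ht
  simpa using this

theorem integral_comp_mul_symm (h : ℝ → ℝ) {β : ℝ} (hβ : β ≠ 0) (a : ℝ) :
    ∫ t in (-a)..a, h (β * t) = |β|⁻¹ * ∫ u in (-(|β| * a))..(|β| * a), h u := by
  rw [intervalIntegral.integral_comp_mul_left _ hβ, smul_eq_mul]
  rcases abs_cases β with ⟨h1, -⟩ | ⟨h1, -⟩ <;> rw [h1]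
  · rw [mul_neg]
  · rw [neg_mul, neg_neg, mul_neg, intervalIntegral.integral_symm, inv_neg]
    ring

theorem eventually_pow_mul_le {ρ ε : ℝ} (h0 : 0 ≤ ρ) (h1 : ρ < 1) (hε : 0 < ε) {q : ℕ} (hq : 0 < q)
    (a : ℝ) : ∀ᶠ N : ℕ in atTop, ρ ^ (q * N) * a ≤ ε := by
  have h2 : Tendsto (fun N : ℕ => ρ ^ (q * N) * a) atTop (𝓝 0) := by
    have := ((tendsto_pow_atTop_nhds_zero_of_lt_one h0 h1).comp
      (tendsto_id.const_mul_atTop' hq)).mul_const a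
    simpa [Function.comp_def] using this
  exact (h2.eventually (gt_mem_nhds hε)).mono fun N hN => hN.le

theorem IsFractalDirection.pow_rpow_holderExp (hd : IsFractalDirection A lam b w) (n : ℕ) :
    (|b| ^ n) ^ holderExp lam b = lam ^ n := by
  simpa using hd.zpow_rpow_holderExp n

/-- The increments of `φ` at the scale `b ^ n`, up to a smooth error. -/
theorem IsFractalDirection.le_abs_skewPhi_sub (hd : IsFractalDirection A lam b w) {C : ℝ}
    (hC : ∀ y s, |skewPhi A lam p (y + line w s) - skewPhi A lam p y
      - twoSided A lam p w s y| ≤ C * |s|) (n : ℕ) (s : ℝ) (y : UnitAddTorus (Fin k)) :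
    lam ^ n * |twoSided A lam p w s (backward A n y)| - C * (|b| ^ n * |s|) ≤
      |skewPhi A lam p (y + line w (b ^ n * s)) - skewPhi A lam p y| := by
  have h1 := hd.twoSided_zpow_mul (p := p) n s y
  rw [zpow_natCast, zpow_natCast] at h1
  have h2 := hC y (b ^ n * s)
  have h3 := abs_sub_abs_le_abs_sub (twoSided A lam p w (b ^ n * s) y)
    (skewPhi A lam p (y + line w (b ^ n * s)) - skewPhi A lam p y)
  rw [abs_sub_comm (twoSided A lam p w (b ^ n * s) y)] at h3
  rw [h1, abs_mul, abs_of_pos (pow_pos hd.lam_pos n), ← h1] at h3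
  rw [abs_mul, abs_pow] at h2
  linarith

theorem IsFractalDirection.hasBoxDim_slice (hd : IsFractalDirection A lam b w)
    (hp : IsBoundedLipschitz p) {x : UnitAddTorus (Fin k)} {s : ℝ}
    (hs : twoSided A lam p w s x ≠ 0) {q : ℕ} (hq : 0 < q)
    (hrec : ∀ N : ℕ, backward A ((q * N : ℕ) : ℤ) x - x ∈ closure (Set.range (line w)))
    {r : ℝ} (hr : 0 < r) :
    HasBoxDim (subSliceGraph A lam p x w r) (2 - holderExp lam b) := by
  have hline := continuous_line w
  have hcont := continuous_skewPhi (A := A) hp hd.lam_pos hd.lam_lt_one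
  have htwo := hd.continuous_twoSided hp s
  have h0 := hd.lam_pos
  have hb0 := hd.abs_pos
  have hr' : -r ≤ r := by linarith
  have hs0 : 0 < |s| := _root_.abs_pos.2 (by rintro rfl; exact hs (twoSided_zero x))
  obtain ⟨K, hK0, hK⟩ := hd.hasDirHolder hp
  obtain ⟨C, hC0, hC⟩ := hd.skewPhi_sub_le hp
  obtain ⟨c, R₀, hc, hR₀, hgrow⟩ := exists_linear_growth (f := fun y => |twoSided A lam p w s y|)
    (by fun_prop) (fun _ => abs_nonneg _) (_root_.abs_pos.2 hs) w
  -- From `N₀` on, the window `[-r/2, r/2]` stretched by `|b|^(-qN)` is long enough for linear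
  -- growth, and the Lipschitz error uses up at most half of the main term.
  obtain ⟨N₀, hN₀⟩ := eventually_atTop.1 ((eventually_pow_mul_le hb0.le hd.abs_lt_one
    (half_pos hr) hq R₀).and (eventually_pow_mul_le (ρ := |b| / lam) (by positivity)
      ((div_lt_one h0).2 hd.abs_lt) (by positivity : 0 < c / 4) hq (C * |s|)))
  obtain ⟨c', δ₀, hc', hδ₀, hscale⟩ := exists_scale (pow_pos hb0 q)
    (pow_lt_one₀ hb0.le hd.abs_lt_one hq.ne') hd.holderExp_pos hs0 N₀
  rw [subSliceGraph_eq]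
  have := hasBoxDim_graph (μ := volume) (s := 1) (κ := 2) (C := K) (α := holderExp lam b)
    (c := c * r / 4 * c') (δ₀ := min δ₀ (r / 2))
    two_pos volume_closedBall_real_le isCompact_Icc (Set.nonempty_Icc.2 hr') (hasCovers_Icc hr)
    (f := fun t => skewPhi A lam p (x + line w t)) (by fun_prop) hd.holderExp_lt_one.le hK0 ?_
    (by positivity) (by positivity) ?_
  · convert this using 1
    norm_num
  · intro y _ z _ δ _ hdist
    rw [add_line_eq x w y z]
    refine (hK _ _).trans (mul_le_mul_of_nonneg_left ?_ hK0)
    rw [← Real.dist_eq]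
    exact Real.rpow_le_rpow dist_nonneg hdist hd.holderExp_pos.le
  · intro δ hδ0 hδ1
    obtain ⟨N, hN, hNδ, hNα⟩ := hscale δ hδ0 (hδ1.trans_le (min_le_left _ _))
    obtain ⟨hN1, hN2⟩ := hN₀ N hN
    rw [← pow_mul] at hNδ hNα
    rw [hd.pow_rpow_holderExp] at hNα
    set n := q * N with hn
    have hτ : |b ^ n * s| ≤ δ := by rwa [abs_mul, abs_pow]
    have hδr : δ < r / 2 := hδ1.trans_le (min_le_right _ _)
    have hlamn : 0 < lam ^ n := pow_pos h0 n
    -- Halving the interval leaves room for the shift, which is at most `δ < r / 2`.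
    refine ⟨fun t => skewPhi A lam p (x + line w (t + b ^ n * s)), Set.Icc (-(r / 2)) (r / 2),
      by fun_prop, isCompact_Icc, measurableSet_Icc, fun y hy z hz => ?_, ?_⟩
    · simp only [line_add, ← add_assoc] at hz
      obtain ⟨t, ht, htz⟩ := exists_mem_uIcc_line hcont _ _ _ hz
      have ht' := abs_le.1 (ht.trans hτ)
      refine ⟨y + t, ⟨by linarith [hy.1], by linarith [hy.2]⟩, ?_, ?_⟩
      · rw [Real.dist_eq, sub_add_cancel_left, abs_neg]; exact ht.trans hτ
      · rw [line_add, ← add_assoc, htz, sub_self, abs_zero]; exact hδ0.le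
    · rw [integral_Icc_eq_integral_Ioc, ← intervalIntegral.integral_of_le (by linarith)]
      have hβ : b ^ (-(n : ℤ)) ≠ 0 := zpow_ne_zero _ hd.ne_zero
      have hβabs : |b ^ (-(n : ℤ))| = (|b| ^ n)⁻¹ := by
        rw [abs_zpow, zpow_neg, zpow_natCast]
      have hlow : ∫ t in (-(r / 2))..(r / 2), (lam ^ n * |twoSided A lam p w s (backward A n x +
          line w (b ^ (-(n : ℤ)) * t))| - C * (|b| ^ n * |s|)) ≤
          ∫ t in (-(r / 2))..(r / 2), |skewPhi A lam p (x + line w (t + b ^ n * s)) -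
            skewPhi A lam p (x + line w t)| := by
        refine intervalIntegral.integral_mono_on (by linarith)
          (Continuous.intervalIntegrable (by fun_prop) _ _)
          (Continuous.intervalIntegrable (by fun_prop) _ _) fun t _ => ?_
        rw [← hd.eigen.backward_add_line hd.ne_zero, line_add, ← add_assoc]
        exact hd.le_abs_skewPhi_sub hC n s _
      refine le_trans ?_ hlow
      rw [intervalIntegral.integral_sub (Continuous.intervalIntegrable (by fun_prop) _ _)
        intervalIntegrable_const, intervalIntegral.integral_const, intervalIntegral.integral_const_mul,
        integral_comp_mul_symm (fun u => |twoSided A lam p w s (backward A n x + line w u)|) hβ,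
        hβabs, inv_inv, smul_eq_mul]
      have hbn : 0 < |b| ^ n := pow_pos hb0 n
      have hg := hgrow _ (hrec N) ((|b| ^ n)⁻¹ * (r / 2)) (by
        rw [← div_eq_inv_mul, le_div_iff₀ hbn, mul_comm]; exact hN1)
      have h2 : c * (r / 2) ≤ |b| ^ n * ∫ u in (-((|b| ^ n)⁻¹ * (r / 2)))..((|b| ^ n)⁻¹ * (r / 2)),
          |twoSided A lam p w s (backward A n x + line w u)| := by
        calc c * (r / 2) = |b| ^ n * (c * ((|b| ^ n)⁻¹ * (r / 2))) := by field_simp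
          _ ≤ _ := by gcongr
      have h3 : C * (|b| ^ n * |s|) ≤ lam ^ n * (c / 4) := by
        rw [div_pow, div_mul_eq_mul_div, div_le_iff₀ hlamn] at hN2
        linarith
      have h4 : lam ^ n * (c * (r / 2)) ≤ lam ^ n * (|b| ^ n *
          ∫ u in (-((|b| ^ n)⁻¹ * (r / 2)))..((|b| ^ n)⁻¹ * (r / 2)),
          |twoSided A lam p w s (backward A n x + line w u)|) := by gcongr
      have h5 : r * (C * (|b| ^ n * |s|)) ≤ r * (lam ^ n * (c / 4)) := by gcongr
      have h6 : c * r / 4 * (c' * δ ^ holderExp lam b) ≤ c * r / 4 * lam ^ n := by gcongr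
      have e : r / 2 - -(r / 2) = r := by ring
      rw [e]
      linarith

theorem abs_sub_le_of_directions {ι : Type*} {f : UnitAddTorus (Fin k) → ℝ} {v : ι → Fin k → ℝ}
    {C : ι → ℝ} {α : ℝ} (h : ∀ i y s, |f (y + line (v i) s) - f y| ≤ C i * |s| ^ α)
    (S : Finset ι) (c : ι → ℝ) (y : UnitAddTorus (Fin k)) :
    |f (y + ∑ i ∈ S, line (v i) (c i)) - f y| ≤ ∑ i ∈ S, C i * |c i| ^ α := by
  classical
  induction S using Finset.induction_on with
  | empty => simp
  | insert i S hi ih =>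
    rw [Finset.sum_insert hi, Finset.sum_insert hi, add_comm (line _ _), ← add_assoc]
    have := abs_sub_le (f (y + ∑ i ∈ S, line (v i) (c i) + line (v i) (c i)))
      (f (y + ∑ i ∈ S, line (v i) (c i))) (f y)
    linarith [h i (y + ∑ i ∈ S, line (v i) (c i)) (c i)]

/-- A short lift of `h` is expanded in the basis `v` and traversed one direction at a time; its
coordinates are bounded by a multiple of `‖h‖`. -/
theorem exists_holder_of_directions {f : UnitAddTorus (Fin k) → ℝ} {v : Fin k → Fin k → ℝ}
    (hv : LinearIndependent ℝ v) {α : ℝ} (hα : 0 < α) (h : ∀ i, HasDirHolder f (v i) α) :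
    ∃ C, 0 ≤ C ∧ ∀ y h, |f (y + h) - f y| ≤ C * ‖h‖ ^ α := by
  choose C hC0 hC using h
  set bv := Module.Basis.mk hv (hv.span_eq_top_of_card_eq_finrank' (by simp)).ge with hbv
  set φ := LinearMap.toContinuousLinearMap (bv.equivFun : (Fin k → ℝ) →ₗ[ℝ] (Fin k → ℝ)) with hφ
  refine ⟨∑ i, C i * ‖φ‖ ^ α, Finset.sum_nonneg fun i _ => mul_nonneg (hC0 i) (by positivity),
    fun y h => ?_⟩
  obtain ⟨u, rfl, hu⟩ := exists_lift h
  have e : torusProj u = ∑ i, line (v i) (φ u i) := by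
    have h1 : ∑ i, φ u i • v i = u := by
      have hbvi : ∀ i, bv i = v i := fun i => by rw [hbv, Module.Basis.mk_apply]
      have := bv.sum_equivFun u
      simp only [hbvi] at this
      exact this
    conv_lhs => rw [← h1]
    exact map_sum (AddMonoidHom.mk' torusProj torusProj_add) _ _
  have h2 := abs_sub_le_of_directions hC Finset.univ (φ u) y
  rw [← e] at h2
  refine h2.trans ?_
  rw [Finset.sum_mul]
  refine Finset.sum_le_sum fun i _ => ?_
  rw [mul_assoc, ← Real.mul_rpow (norm_nonneg _) (norm_nonneg _)]
  refine mul_le_mul_of_nonneg_left (Real.rpow_le_rpow (abs_nonneg _) ?_ hα.le) (hC0 i)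
  exact ((norm_le_pi_norm (φ u) i).trans (φ.le_opNorm u)).trans
    (mul_le_mul_of_nonneg_left hu (norm_nonneg _))

theorem integral_comp_backward {f : UnitAddTorus (Fin k) → ℝ} (hf : Continuous f) (n : ℤ) :
    ∫ y, f (backward A n y) = ∫ y, f y := by
  have hmp := measurePreserving_toralMap (A ^ (-n))
  have := integral_map hmp.measurable.aemeasurable
    (hf.aestronglyMeasurable (μ := Measure.map (toralMap (A ^ (-n))) volume))
  rw [hmp.map_eq] at this
  exact this.symm

/-- The lower bound averages over the torus rather than along a line: `A` preserves the measure, so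
the mean of `|G_s ∘ A^{-n}|` does not depend on `n`, and no recurrence of `x` is needed. -/
theorem IsFractalDirection.hasBoxDim_phiGraph (hd : IsFractalDirection A lam b w)
    (hp : IsBoundedLipschitz p) {x : UnitAddTorus (Fin k)} {s : ℝ}
    (hs : twoSided A lam p w s x ≠ 0) {K : ℝ} (hK0 : 0 ≤ K)
    (hK : ∀ y h, |skewPhi A lam p (y + h) - skewPhi A lam p y| ≤ K * ‖h‖ ^ holderExp lam b) :
    HasBoxDim (phiGraph A lam p) (k + 1 - holderExp lam b) := by
  have hcont := continuous_skewPhi (A := A) hp hd.lam_pos hd.lam_lt_one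
  have htwo := hd.continuous_twoSided hp s
  have h0 := hd.lam_pos
  have hb0 := hd.abs_pos
  have hs0 : 0 < |s| := _root_.abs_pos.2 (by rintro rfl; exact hs (twoSided_zero x))
  obtain ⟨C, hC0, hC⟩ := hd.skewPhi_sub_le hp
  have hint : ∀ f : UnitAddTorus (Fin k) → ℝ, Continuous f → Integrable f := fun f hf =>
    hf.integrable_of_hasCompactSupport (HasCompactSupport.of_compactSpace f)
  set I : ℝ := ∫ y, |twoSided A lam p w s y| with hI
  have hI0 : 0 < I :=
    Continuous.integral_pos_of_hasCompactSupport_nonneg_nonzero (x := x) (by fun_prop)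
      (HasCompactSupport.of_compactSpace _) (fun _ => abs_nonneg _) (abs_ne_zero.2 hs)
  obtain ⟨N₀, hN₀⟩ := eventually_atTop.1 (eventually_pow_mul_le (ρ := |b| / lam) (by positivity)
      ((div_lt_one h0).2 hd.abs_lt) (half_pos hI0) one_pos (C * |s|))
  have hs1 : 0 < |s| * (‖w‖ + 1) := by positivity
  obtain ⟨c', δ₀, hc', hδ₀, hscale⟩ := exists_scale hb0 hd.abs_lt_one hd.holderExp_pos hs1 N₀
  have e : phiGraph A lam p = (fun y => (y, skewPhi A lam p y)) '' Set.univ := by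
    rw [Set.image_univ]; rfl
  rw [e]
  refine hasBoxDim_graph (μ := volume) (κ := 2 ^ k) (C := K) (c := I / 2 * c') (δ₀ := δ₀)
    (by positivity) volume_closedBall_torus_le isCompact_univ Set.univ_nonempty (hasCovers_torus k)
    hcont hd.holderExp_lt_one.le hK0 ?_ (by positivity) hδ₀ ?_
  · intro y _ z _ δ _ hdist
    have := hK z (y - z)
    rw [add_sub_cancel] at this
    refine this.trans (mul_le_mul_of_nonneg_left ?_ hK0)
    rw [← dist_eq_norm]
    exact Real.rpow_le_rpow dist_nonneg hdist hd.holderExp_pos.le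
  · intro δ hδ0 hδ1
    obtain ⟨n, hn, hnδ, hnα⟩ := hscale δ hδ0 hδ1
    have hn2 := hN₀ n hn
    rw [one_mul] at hn2
    rw [hd.pow_rpow_holderExp] at hnα
    have hlamn : 0 < lam ^ n := pow_pos h0 n
    have hτ : |b ^ n * s| * ‖w‖ ≤ δ := by
      rw [abs_mul, abs_pow, mul_assoc]
      exact (by gcongr; linarith : |b| ^ n * (|s| * ‖w‖) ≤ |b| ^ n * (|s| * (‖w‖ + 1))).trans hnδ
    refine ⟨fun y => skewPhi A lam p (y + line w (b ^ n * s)), Set.univ, by fun_prop,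
      isCompact_univ, MeasurableSet.univ, fun y _ z hz => ?_, ?_⟩
    · obtain ⟨t, ht, htz⟩ := exists_mem_uIcc_line hcont _ _ _ hz
      refine ⟨y + line w t, trivial, ?_, ?_⟩
      · rw [dist_eq_norm, sub_add_cancel_left, norm_neg]
        exact ((norm_line_le w t).trans (by gcongr)).trans hτ
      · rw [htz, sub_self, abs_zero]; exact hδ0.le
    · rw [setIntegral_univ]
      have hbk := continuous_backward A n
      have hlow : ∫ y, (lam ^ n * |twoSided A lam p w s (backward A n y)| - C * (|b| ^ n * |s|)) ≤
          ∫ y, |skewPhi A lam p (y + line w (b ^ n * s)) - skewPhi A lam p y| :=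
        integral_mono (hint _ (by fun_prop)) (hint _ (by fun_prop)) fun y =>
          hd.le_abs_skewPhi_sub hC n s y
      refine le_trans ?_ hlow
      rw [integral_sub (hint _ (by fun_prop)) (integrable_const _), integral_const_mul,
        integral_comp_backward (f := fun y => |twoSided A lam p w s y|) (by fun_prop)]
      simp only [integral_const, probReal_univ, smul_eq_mul, one_mul]
      rw [div_pow, div_mul_eq_mul_div, div_le_iff₀ hlamn] at hn2
      have h6 : I / 2 * (c' * δ ^ holderExp lam b) ≤ I / 2 * lam ^ n := by gcongr
      rw [← hI]
      linarith

theorem backward_eq_self_of_isPeriodicPt {x : UnitAddTorus (Fin k)} {q : ℕ}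
    (hx : Function.IsPeriodicPt (toralMap A) q x) (N : ℕ) :
    backward A ((q * N : ℕ) : ℤ) x = x := by
  have hiter : ∀ n : ℕ, toralMap (A ^ n) x = (toralMap A)^[n] x := by
    intro n
    induction n with
    | zero => simp [toralMap_one]
    | succ n ih => rw [pow_succ', toralMap_mul, ih, Function.iterate_succ_apply']
  have h1 : toralMap (A ^ (q * N)) x = x := by
    rw [hiter]; exact hx.mul_const N
  conv_lhs => rw [← h1]
  rw [backward, ← toralMap_mul, zpow_neg, zpow_natCast, inv_mul_cancel, toralMap_one]

theorem holderExp_le {b b' : ℝ} (h0 : 0 < lam) (h1 : lam < 1) (hb : 0 < |b|) (hbb : |b| ≤ |b'|)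
    (hb' : |b'| < 1) : holderExp lam b ≤ holderExp lam b' := by
  have h2 := Real.log_neg h0 h1
  have h3 := Real.log_neg (hb.trans_le hbb) hb'
  have h4 := Real.log_le_log hb hbb
  rw [holderExp, holderExp, ← neg_div_neg_eq, ← neg_div_neg_eq (Real.log lam) (Real.log |b'|)]
  gcongr <;> linarith

end SkewSlice

/-! ### The theorem. -/

open SkewSlice

theorem mainTheorem1 {k : ℕ} (A : GL (Fin k) ℤ) (B : Fin k → ℝ) (v : Fin k → Fin k → ℝ)
    (hA : IsAnosovEigensystem A B v)
    (p : UnitAddTorus (Fin k) → ℝ) (hp : TorusContDiff (k + 1) p)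
    (lam : ℝ) (hlam0 : 0 < lam) (hlam1 : lam < 1)
    (l : Fin k) (hl : |B l| < lam) (hl' : ∀ i, l < i → lam < |B i|)
    (x : UnitAddTorus (Fin k))
    (i₀ : Fin k) (hi₀ : HasNonzeroCoeff A lam p x (B i₀) (v i₀))
    (hmin : ∀ i, i < i₀ → ¬ HasNonzeroCoeff A lam p x (B i) (v i))
    (hx : Irreducible (A : Matrix (Fin k) (Fin k) ℤ).charpoly ∨
      (x ∈ Function.periodicPts (toralMap A) ∧
        ∀ i, i < i₀ → ∀ y, ¬ HasNonzeroCoeff A lam p y (B i) (v i)))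
    (i₁ : Fin k) (hi₀₁ : i₀ < i₁) (hi₁l : i₁ ≤ l)
    (hi₁ : HasNonzeroCoeff A lam p x (B i₁) (v i₁))
    (r : ℝ) (hr : 0 < r) :
    ∃ (d : ℝ) (e : Fin k → ℝ), HasBoxDim (phiGraph A lam p) d ∧
      (∀ i, HasBoxDim (subSliceGraph A lam p x (v i) r) (e i)) ∧
      d < ∑ i, e i := by
  have hpL : IsBoundedLipschitz p :=
    ⟨continuous_of_torusContDiff hp, exists_bound (continuous_of_torusContDiff hp),
      exists_lipschitz (Nat.le_add_left 1 k) hp⟩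
  have hcont := continuous_skewPhi (A := A) hpL hlam0 hlam1
  have hv0 : ∀ i, v i ≠ 0 := fun i => hA.linearIndependent.ne_zero i
  have heig : ∀ i, IsEigen A (B i) (v i) := hA.eigen
  have hB0 : ∀ i, B i ≠ 0 := fun i => (heig i).ne_zero (hv0 i)
  have hmono : ∀ i j, i ≤ j → |B i| ≤ |B j| := fun i j hij => hA.strictMono.monotone hij
  have hfrac : ∀ i, i ≤ l → IsFractalDirection A lam (B i) (v i) := fun i hi =>
    ⟨heig i, hB0 i, hlam0, hlam1, (hmono i l hi).trans_lt hl⟩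
  have hirr : Irreducible (A : Matrix (Fin k) (Fin k) ℤ).charpoly →
      ∀ i, closure (Set.range (line (v i))) = Set.univ := fun h i =>
    dense_line fun m hm => sum_mul_ne_zero_of_irreducible h (heig i) (hv0 i) hm
  have hrec : ∃ q : ℕ, 0 < q ∧ ∀ i, ∀ N : ℕ,
      backward A ((q * N : ℕ) : ℤ) x - x ∈ closure (Set.range (line (v i))) := by
    rcases hx with h | ⟨⟨q, hq, hper⟩, -⟩
    · exact ⟨1, one_pos, fun i N => by rw [hirr h i]; trivial⟩
    · refine ⟨q, hq, fun i N => ?_⟩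
      rw [backward_eq_self_of_isPeriodicPt hper N, sub_self]
      exact subset_closure ⟨0, line_zero _⟩
  obtain ⟨q, hq, hrec⟩ := hrec
  -- In the irreducible case, vanishing at `x` spreads along the line through `x` and, by density
  -- and continuity, to the whole torus.
  have hzero : ∀ i, i < i₀ → ∀ y s, twoSided A lam p (v i) s y = 0 := by
    intro i hi y s
    have hd := hfrac i (hi.le.trans (hi₀₁.le.trans hi₁l))
    rcases hx with h | ⟨-, h⟩
    · have hline : Set.EqOn (fun z => twoSided A lam p (v i) s (x + z)) (fun _ => 0)
          (closure (Set.range (line (v i)))) := by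
        refine Set.EqOn.closure ?_ ((hd.continuous_twoSided hpL s).comp (continuous_const_add x))
          continuous_const
        rintro _ ⟨t, rfl⟩
        exact hd.twoSided_add_line_eq_zero hpL (hd.twoSided_eq_zero hpL (hmin i hi)) s t
      have := hline (x := y - x) (by rw [hirr h i]; trivial)
      simpa using this
    · exact hd.twoSided_eq_zero hpL (h i hi y) s
  have hl₀ : i₀ ≤ l := hi₀₁.le.trans hi₁l
  have hd₀ := hfrac i₀ hl₀
  set α : Fin k → ℝ := fun i => holderExp lam (B i) with hα
  have hlip : ∀ i, l < i → ∃ C, 0 ≤ C ∧ ∀ y s, |skewPhi A lam p (y + line (v i) s) -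
      skewPhi A lam p y| ≤ C * |s| := fun i hi =>
    skewPhi_lipschitz_of_lt hpL hlam0 hlam1 (heig i) (hB0 i) (hl' i hi)
  -- Directions before `i₀` or beyond `l` are Lipschitz; from `i₀` to `l` the exponent increases
  -- with `|B i|`, so `α i₀` serves for all.
  have hdir : ∀ i, HasDirHolder (skewPhi A lam p) (v i) (α i₀) := by
    intro i
    have hweak : (∃ C, 0 ≤ C ∧ ∀ y s, |skewPhi A lam p (y + line (v i) s) -
        skewPhi A lam p y| ≤ C * |s|) → HasDirHolder (skewPhi A lam p) (v i) (α i₀) := by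
      rintro ⟨C, hC0, hC⟩
      exact HasDirHolder.mono hcont ⟨C, hC0, fun y s => by simpa using hC y s⟩
        hd₀.holderExp_pos hd₀.holderExp_lt_one.le
    rcases lt_or_ge l i with hi | hi
    · exact hweak (hlip i hi)
    · rcases lt_or_ge i i₀ with hi' | hi'
      · obtain ⟨C, hC0, hC⟩ := (hfrac i hi).skewPhi_lipschitz_line hpL
        exact hweak ⟨C, hC0, fun y s => hC y (hzero i hi' y) s⟩
      · exact ((hfrac i hi).hasDirHolder hpL).mono hcont hd₀.holderExp_pos
          (holderExp_le hlam0 hlam1 hd₀.abs_pos (hmono _ _ hi') (hfrac i hi).abs_lt_one)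
  obtain ⟨K, hK0, hK⟩ := exists_holder_of_directions hA.linearIndependent hd₀.holderExp_pos hdir
  obtain ⟨s₀, hs₀⟩ := hd₀.exists_twoSided_ne_zero hpL hi₀
  have hslice : ∀ i, ∃ e, HasBoxDim (subSliceGraph A lam p x (v i) r) e ∧ 1 ≤ e ∧
      (i ≤ l → HasNonzeroCoeff A lam p x (B i) (v i) → e = 2 - α i) := by
    intro i
    rcases lt_or_ge l i with hi | hi
    · obtain ⟨C, hC0, hC⟩ := hlip i hi
      exact ⟨1, hasBoxDim_slice_of_lipschitz hC0 hcont (fun t s => hC _ s) hr, le_rfl,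
        fun h => absurd hi (not_lt.2 h)⟩
    · have hd := hfrac i hi
      by_cases h : HasNonzeroCoeff A lam p x (B i) (v i)
      · obtain ⟨s, hs⟩ := hd.exists_twoSided_ne_zero hpL h
        exact ⟨2 - α i, hd.hasBoxDim_slice hpL hs hq (hrec i) hr,
          by linarith [hd.holderExp_lt_one], fun _ _ => rfl⟩
      · obtain ⟨C, hC0, hC⟩ := hd.skewPhi_lipschitz_line hpL
        refine ⟨1, hasBoxDim_slice_of_lipschitz hC0 hcont (fun t s => hC _ (fun s => ?_) s) hr,
          le_rfl, fun _ h' => absurd h' h⟩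
        exact hd.twoSided_add_line_eq_zero hpL (hd.twoSided_eq_zero hpL h) s t
  choose e he he1 he2 using hslice
  refine ⟨k + 1 - α i₀, e, hd₀.hasBoxDim_phiGraph hpL hs₀ hK0 hK, he, ?_⟩
  have h0 := he2 i₀ hl₀ hi₀
  have h1 := he2 i₁ hi₁l hi₁
  have hα1 : α i₁ < 1 := (hfrac i₁ hi₁l).holderExp_lt_one
  -- The excesses over `1` are nonnegative; the one at `i₀` equals that of the full graph over `k`,
  -- and the one at `i₁` makes the inequality strict.
  have hsum : ∑ i ∈ {i₀, i₁}, (e i - 1) ≤ ∑ i, (e i - 1) :=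
    Finset.sum_le_sum_of_subset_of_nonneg (Finset.subset_univ _)
      fun i _ _ => sub_nonneg.2 (he1 i)
  rw [Finset.sum_pair hi₀₁.ne, Finset.sum_sub_distrib] at hsum
  simp only [Finset.sum_const, Finset.card_univ, Fintype.card_fin, nsmul_eq_mul, mul_one] at hsum
  linarith
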